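/- For $A\subset\mathbb R^n$ finite and $d\ge 1$ let $I_{1,d}(A)$ be the space of real polynomials of degree $\le d$ in $n$ variables vanishing on $A$; let $I_{2,2d}(A)$ be the space of real polynomials of degree $\le 2d$ that vanish on $A$ together with all first partial derivatives; let $I_{1,d}^2(A)$ be the space of finite sums $\sum_i p_iq_i$ with $p_i,q_i\in I_{1,d}(A)$; and let $\tilde A$ be the set of points of $\mathbb R^n\smallsetminus A$ at which all of $I_{1,d}(A)$ vanishes. A polynomial is psd (positive) if it is $\ge 0$ on $\mathbb R^n$, and sos if it is a sum of squares of real polynomials. The hypotheses of Hilbert's Method (in degree $d$) hold for $A$, a basis $f_1,\dots,f_s$ of $I_{1,d}(A)$, and a polynomial $g$ if: $\tilde A$ is finite; for all $\pi\in A$ and $v\in\mathbb R^n$ there is $p\in I_{1,d}(A)$ with $\nabla p(\pi)=v$; $\sum_j f_j^2$ has no real zeros at infinity (its component of degree $2d$ vanishes at no nonzero $v\in\mathbb R^n$); and $g\in I_{2,2d}(A)\smallsetminus I_{1,d}^2(A)$ with $g(w)>0$ for every $w\in\tilde A$. Hilbert's Method applies to $A$ if these hypotheses hold for some basis and some $g$,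 and if, whenever they hold for a basis $(f_j)$ and a polynomial $g$, there is $c>0$ such that $\sum_j f_j^2+cg$ is psd and not sos. **Theorem.** Let $f_1,f_2\in\mathbb R[x,y]$ be relatively prime polynomials of degree $3$ with exactly nine distinct common zeros in $\mathbb R^2$, and let $A$ be any eight of these zeros. Then Hilbert's Method, with $d=3$, applies to $A$, and there is a psd polynomial in $\mathbb R[x,y]$ of degree $6$ that vanishes on $A$ and is not sos. **Corollary.** More generally, let $A\subset\mathbb R^2$ be a set of eight points, at most three of them on any line and at most six of them on any quadratic (i.e. zeros of any nonzero polynomial of degree $\le 2$). Suppose $A$ is copacetic, that is, all members of $I_{1,3}(A)$, homogenized to ternary cubic forms, have a further common real zero in the projective plane, either a point of $\mathbb R^2\smallsetminus A$ or a point at infinity. Then there is a psd polynomial in $\mathbb R[x,y]$ of degree $6$ that vanishes on $A$ and is not sos. -/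

import Mathlib

namespace HilbertMethod

open MvPolynomial

/-- The set of real zeros of a real polynomial in `n` variables. -/
def zeros {n : ℕ} (p : MvPolynomial (Fin n) ℝ) : Set (Fin n → ℝ) :=
  {x | eval x p = 0}

/-- A polynomial is psd (in other words "positive") if it takes only non-negative values. -/
def IsPsd {n : ℕ} (p : MvPolynomial (Fin n) ℝ) : Prop :=
  ∀ x : Fin n → ℝ, 0 ≤ eval x p

/-- `I_{1,d}(A)`: the real polynomials of degree at most `d` that vanish at every point
of `A`. -/
def vanishingSpace {n : ℕ} (d : ℕ) (A : Set (Fin n → ℝ)) :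
    Submodule ℝ (MvPolynomial (Fin n) ℝ) where
  carrier := {p | p.totalDegree ≤ d ∧ ∀ a ∈ A, eval a p = 0}
  zero_mem' := by simp
  add_mem' := by
    rintro p q ⟨hp, hp'⟩ ⟨hq, hq'⟩
    refine ⟨(totalDegree_add p q).trans (max_le hp hq), fun a ha => ?_⟩
    simp [hp' a ha, hq' a ha]
  smul_mem' := by
    rintro c p ⟨hp, hp'⟩
    refine ⟨(totalDegree_smul_le c p).trans hp, fun a ha => ?_⟩
    simp [hp' a ha]

/-- `I_{2,e}(A)`: the real polynomials of degree at most `e` that vanish, together with all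
their first partial derivatives, at every point of `A`. -/
def singularSpace {n : ℕ} (e : ℕ) (A : Set (Fin n → ℝ)) :
    Submodule ℝ (MvPolynomial (Fin n) ℝ) where
  carrier := {p | p.totalDegree ≤ e ∧
    ∀ a ∈ A, eval a p = 0 ∧ ∀ i : Fin n, eval a (pderiv i p) = 0}
  zero_mem' := by simp
  add_mem' := by
    rintro p q ⟨hp, hp'⟩ ⟨hq, hq'⟩
    refine ⟨(totalDegree_add p q).trans (max_le hp hq), fun a ha => ⟨?_, fun i => ?_⟩⟩
    · simp [(hp' a ha).1, (hq' a ha).1]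
    · simp [(hp' a ha).2 i, (hq' a ha).2 i]
  smul_mem' := by
    rintro c p ⟨hp, hp'⟩
    refine ⟨(totalDegree_smul_le c p).trans hp, fun a ha => ⟨?_, fun i => ?_⟩⟩
    · simp [(hp' a ha).1]
    · simp [(hp' a ha).2 i]

/-- `I_{1,d}²(A)`: the finite sums of products `p * q` with `p`, `q` in `I_{1,d}(A)`. -/
noncomputable def squareSpace {n : ℕ} (d : ℕ) (A : Set (Fin n → ℝ)) :
    Submodule ℝ (MvPolynomial (Fin n) ℝ) :=
  vanishingSpace d A * vanishingSpace d A

/-- The forced zeros of `A`: the points outside `A` at which all of `I_{1,d}(A)` vanishes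
(equivalently, all members of a basis of it). -/
def forcedZeros {n : ℕ} (d : ℕ) (A : Set (Fin n → ℝ)) : Set (Fin n → ℝ) :=
  {x | ∀ p ∈ vanishingSpace d A, eval x p = 0} \ A

/-- `I_{1,d}(A)` is full: at each point of `A`, every vector is the gradient of a member. -/
def IsFull {n : ℕ} (d : ℕ) (A : Set (Fin n → ℝ)) : Prop :=
  ∀ a ∈ A, ∀ v : Fin n → ℝ, ∃ p ∈ vanishingSpace d A, ∀ i : Fin n, eval a (pderiv i p) = v i

/-- A polynomial `p` of degree at most `m`, homogenized to a form of degree `m`, has the zero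
`(v, 0)` at infinity: the value of that form at `(v, 0)` is the value at `v` of the
degree-`m` homogeneous component of `p`. -/
def ZeroAtInfinity {n : ℕ} (m : ℕ) (p : MvPolynomial (Fin n) ℝ) (v : Fin n → ℝ) : Prop :=
  v ≠ 0 ∧ eval v (homogeneousComponent m p) = 0

/-- The circumstances under which Hilbert's Method is run, with the finite set `A`, the basis
`f` of `I_{1,d}(A)` and the perturbing polynomial `g` of degree at most `2d`. -/
structure Hypotheses {n s : ℕ} (d : ℕ) (A : Set (Fin n → ℝ))
    (f : Fin s → MvPolynomial (Fin n) ℝ) (g : MvPolynomial (Fin n) ℝ) : Prop where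
  finite : A.Finite
  linearIndependent : LinearIndependent ℝ f
  span_eq : Submodule.span ℝ (Set.range f) = vanishingSpace d A
  finite_forcedZeros : (forcedZeros d A).Finite
  full : IsFull d A
  no_zeros_at_infinity : ∀ v : Fin n → ℝ, ¬ ZeroAtInfinity (2 * d) (∑ j, f j ^ 2) v
  g_mem : g ∈ singularSpace (2 * d) A
  g_not_mem : g ∉ squareSpace d A
  g_pos : ∀ w ∈ forcedZeros d A, 0 < eval w g

/-- Hilbert's Method (with cubics if `d = 3`) applies to `A`: its hypotheses can be met, and
whenever they are met by a basis `f` and a polynomial `g`, some perturbation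
`∑ f_j² + c g` with `c > 0` is psd and not a sum of squares of polynomials. -/
def Applies {n : ℕ} (d : ℕ) (A : Set (Fin n → ℝ)) : Prop :=
  (∃ (s : ℕ) (f : Fin s → MvPolynomial (Fin n) ℝ) (g : MvPolynomial (Fin n) ℝ),
    Hypotheses d A f g) ∧
  ∀ (s : ℕ) (f : Fin s → MvPolynomial (Fin n) ℝ) (g : MvPolynomial (Fin n) ℝ),
    Hypotheses d A f g →
      ∃ c : ℝ, 0 < c ∧ IsPsd (∑ j, f j ^ 2 + C c * g) ∧ ¬ IsSumSq (∑ j, f j ^ 2 + C c * g)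

/-- Eight points of the plane, no four on a line and no seven on a quadratic (reducible or
not), are copacetic if all the cubics through them share a ninth zero, which may lie at
infinity. -/
structure IsCopacetic (A : Set (Fin 2 → ℝ)) : Prop where
  ncard_eq : A.ncard = 8
  line : ∀ l : MvPolynomial (Fin 2) ℝ, l ≠ 0 → l.totalDegree ≤ 1 → (A ∩ zeros l).ncard < 4
  quadratic : ∀ q : MvPolynomial (Fin 2) ℝ, q ≠ 0 → q.totalDegree ≤ 2 →
    (A ∩ zeros q).ncard < 7
  ninth : (forcedZeros 3 A).Nonempty ∨
    ∃ v : Fin 2 → ℝ, ∀ p ∈ vanishingSpace 3 A, ZeroAtInfinity 3 p v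

/-- There is a psd polynomial of degree six that vanishes on `A` and is not sos. -/
def HasPsdNotSosSextic (A : Set (Fin 2 → ℝ)) : Prop :=
  ∃ p : MvPolynomial (Fin 2) ℝ,
    p.totalDegree = 6 ∧ IsPsd p ∧ A ⊆ zeros p ∧ ¬ IsSumSq p

end HilbertMethod

/-! Positivity is a compactness argument on the projective closure. On the unit sphere of pairs `(x,
t)`, let F and G be the homogenizations of `∑ f_j²` and `g`. Where F > 0, small c does no harm. At a
point of `A`, fullness makes F dominate the squared distance, while G is only of that order because
`g` is singular there. At any other common zero of the `f_j`, G > 0 is assumed. So F + cG ≥ 0 for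
all small c > 0 (`exists_isPsd_add`). If the sum were sos, each polynomial squared would have degree
at most d and vanish on `A`, which would put `g` in `squareSpace d A` (`not_isSumSq_add`).

It remains to find `g`. Counting dimensions with the Koszul relation gives Bezout's inequality, and,
when two cubics attain nine common zeros, Noether's theorem: every form of degree at least 4
vanishing at the nine points is u f₁ + w f₂ with u, w of the expected degrees
(`IsPointSet.exists_eq_of_cubics`). Three consequences follow. Cubics through eight of the points
form the pencil spanned by f₁, f₂ (Cayley–Bacharach); f₁ and f₂ meet transversally at each affine
point; a sextic singular on `A` and zero at the ninth point lies in `squareSpace 3 A`. Sextics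
singular on `A` form a space of dimension at least 28 - 24 = 4, and `squareSpace 3 A` has dimension
at most 3. So some singular sextic lies outside it, is nonzero at the ninth point, and has the right
sign up to negation.

All of this is projective in the ninth point, so the corollary only needs a relatively prime pair of
cubics through a copacetic set; the bounds on lines and quadratics exclude a common factor. -/

namespace HilbertMethod

open MvPolynomial Filter Topology

/-! ### Homogenization -/

/-- The value at `(x, t)` of the homogenization to degree `m` of a polynomial. -/
noncomputable def homEval {n : ℕ} (m : ℕ) (P : (Fin n → ℝ) × ℝ) :
    MvPolynomial (Fin n) ℝ →ₗ[ℝ] ℝ :=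
  ∑ k ∈ Finset.range (m + 1),
    P.2 ^ (m - k) • ((aeval P.1).toLinearMap ∘ₗ homogeneousComponent k)

theorem homEval_apply {n : ℕ} (m : ℕ) (P : (Fin n → ℝ) × ℝ) (p : MvPolynomial (Fin n) ℝ) :
    homEval m P p = ∑ k ∈ Finset.range (m + 1),
      P.2 ^ (m - k) * eval P.1 (homogeneousComponent k p) := by
  simp [homEval, LinearMap.sum_apply, MvPolynomial.aeval_eq_eval]

theorem eval_smul_of_isHomogeneous {n k : ℕ} {p : MvPolynomial (Fin n) ℝ}
    (hp : p.IsHomogeneous k) (c : ℝ) (x : Fin n → ℝ) :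
    eval (c • x) p = c ^ k * eval x p := by
  rw [eval_eq, eval_eq, Finset.mul_sum]
  refine Finset.sum_congr rfl fun d hd => ?_
  have h : ∏ i ∈ d.support, c ^ d i = c ^ k := by
    rw [Finset.prod_pow_eq_pow_sum, ← hp.degree_eq_sum_deg_support hd]
  simp only [Pi.smul_apply, smul_eq_mul, mul_pow, Finset.prod_mul_distrib, h]
  ring

theorem homEval_smul {n : ℕ} (m : ℕ) (c : ℝ) (P : (Fin n → ℝ) × ℝ)
    (p : MvPolynomial (Fin n) ℝ) : homEval m (c • P) p = c ^ m * homEval m P p := by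
  simp only [homEval_apply, Prod.smul_fst, Prod.smul_snd, Finset.mul_sum]
  refine Finset.sum_congr rfl fun k hk => ?_
  rw [eval_smul_of_isHomogeneous (homogeneousComponent_isHomogeneous k p), smul_eq_mul, mul_pow]
  have h : c ^ m = c ^ (m - k) * c ^ k := by
    rw [← pow_add, Nat.sub_add_cancel (Finset.mem_range_succ_iff.mp hk)]
  rw [h]; ring

theorem sum_homogeneousComponent_of_le {n m : ℕ} {p : MvPolynomial (Fin n) ℝ}
    (hp : p.totalDegree ≤ m) :
    ∑ k ∈ Finset.range (m + 1), homogeneousComponent k p = p := by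
  conv_rhs => rw [← sum_homogeneousComponent p]
  symm
  refine Finset.sum_subset (Finset.range_mono (by omega)) fun k _ hk => ?_
  exact homogeneousComponent_eq_zero _ _ (by simpa using hk)

theorem homEval_one {n m : ℕ} {p : MvPolynomial (Fin n) ℝ} (hp : p.totalDegree ≤ m)
    (x : Fin n → ℝ) : homEval m (x, 1) p = eval x p := by
  conv_rhs => rw [← sum_homogeneousComponent_of_le hp]
  simp [homEval_apply]

theorem homEval_zero {n : ℕ} (m : ℕ) (p : MvPolynomial (Fin n) ℝ)
    (x : Fin n → ℝ) : homEval m (x, 0) p = eval x (homogeneousComponent m p) := by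
  rw [homEval_apply, Finset.sum_range_succ, Finset.sum_eq_zero]
  · simp
  · intro k hk
    rw [Finset.mem_range] at hk
    simp [Nat.sub_ne_zero_of_lt hk]

theorem homEval_of_ne_zero {n m : ℕ} {p : MvPolynomial (Fin n) ℝ} (hp : p.totalDegree ≤ m)
    (x : Fin n → ℝ) {t : ℝ} (ht : t ≠ 0) :
    homEval m (x, t) p = t ^ m * eval (t⁻¹ • x) p := by
  have h : (x, t) = t • ((t⁻¹ • x, 1) : (Fin n → ℝ) × ℝ) := by
    simp [smul_smul, ht]
  rw [h, homEval_smul, homEval_one hp]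

theorem continuous_homEval {n : ℕ} (m : ℕ) (p : MvPolynomial (Fin n) ℝ) :
    Continuous fun P : (Fin n → ℝ) × ℝ => homEval m P p := by
  simp only [homEval_apply]
  refine continuous_finsetSum _ fun k _ => (continuous_snd.pow _).mul ?_
  exact (MvPolynomial.continuous_eval _).comp continuous_fst

/-- For t ≠ 0 everything reduces by scaling to multiplicativity of `eval`; the points with t = 0
follow by continuity. -/
theorem homEval_mul {n a b : ℕ} {p q : MvPolynomial (Fin n) ℝ} (hp : p.totalDegree ≤ a)
    (hq : q.totalDegree ≤ b) (P : (Fin n → ℝ) × ℝ) :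
    homEval (a + b) P (p * q) = homEval a P p * homEval b P q := by
  have key : ∀ x : Fin n → ℝ, (fun t : ℝ => homEval (a + b) (x, t) (p * q)) =
      fun t => homEval a (x, t) p * homEval b (x, t) q := by
    intro x
    refine Continuous.ext_on (dense_compl_singleton (0 : ℝ))
      ((continuous_homEval _ _).comp (by fun_prop))
      (((continuous_homEval _ _).comp (by fun_prop)).mul
        ((continuous_homEval _ _).comp (by fun_prop))) fun t ht => ?_
    have ht : t ≠ 0 := ht
    rw [homEval_of_ne_zero ((totalDegree_mul p q).trans (add_le_add hp hq)) x ht,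
      homEval_of_ne_zero hp x ht, homEval_of_ne_zero hq x ht, map_mul, pow_add]
    ring
  exact congrFun (key P.1) P.2

theorem homEval_X {n : ℕ} (i : Fin n) (P : (Fin n → ℝ) × ℝ) :
    homEval 1 P (X i : MvPolynomial (Fin n) ℝ) = P.1 i := by
  have h0 : homogeneousComponent 0 (X i : MvPolynomial (Fin n) ℝ) = 0 := by
    rw [homogeneousComponent_of_mem (isHomogeneous_X ℝ i)]; simp
  have h1 : homogeneousComponent 1 (X i : MvPolynomial (Fin n) ℝ) = X i :=
    homogeneousComponent_eq_self (isHomogeneous_X ℝ i)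
  simp [homEval_apply, Finset.sum_range_succ, h0, h1]

theorem homEval_C {n : ℕ} (c : ℝ) (P : (Fin n → ℝ) × ℝ) :
    homEval 1 P (C c : MvPolynomial (Fin n) ℝ) = c * P.2 := by
  have h1 : homogeneousComponent 1 (C c : MvPolynomial (Fin n) ℝ) = 0 := by
    rw [homogeneousComponent_of_mem (isHomogeneous_C _ c)]; simp
  simp [homEval_apply, Finset.sum_range_succ, h1, mul_comm]

theorem homogeneousComponent_mul_of_le {n a b : ℕ} {p q : MvPolynomial (Fin n) ℝ}
    (hp : p.totalDegree ≤ a) (hq : q.totalDegree ≤ b) :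
    homogeneousComponent (a + b) (p * q) =
      homogeneousComponent a p * homogeneousComponent b q := by
  refine MvPolynomial.funext fun x => ?_
  rw [eval_mul, ← homEval_zero, ← homEval_zero, ← homEval_zero, homEval_mul hp hq]

theorem homEval_sum_sq {n d s : ℕ} {f : Fin s → MvPolynomial (Fin n) ℝ}
    (hf : ∀ j, (f j).totalDegree ≤ d) (P : (Fin n → ℝ) × ℝ) :
    homEval (2 * d) P (∑ j, f j ^ 2) = ∑ j, homEval d P (f j) ^ 2 := by
  rw [map_sum]
  refine Finset.sum_congr rfl fun j _ => ?_
  rw [sq, sq, two_mul, homEval_mul (hf j) (hf j)]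

theorem totalDegree_sum_sq_le {n d s : ℕ} {f : Fin s → MvPolynomial (Fin n) ℝ}
    (hf : ∀ j, (f j).totalDegree ≤ d) : (∑ j, f j ^ 2).totalDegree ≤ 2 * d :=
  (totalDegree_finsetSum _ _).trans <| Finset.sup_le fun j _ =>
    (totalDegree_pow _ _).trans (Nat.mul_le_mul_left 2 (hf j))

theorem eval_sum_sq {n s : ℕ} (f : Fin s → MvPolynomial (Fin n) ℝ) (x : Fin n → ℝ) :
    eval x (∑ j, f j ^ 2) = ∑ j, eval x (f j) ^ 2 := by
  simp

theorem totalDegree_le_of_homogeneousComponent_eq_zero {n m : ℕ} {p : MvPolynomial (Fin n) ℝ}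
    (hp : p.totalDegree ≤ m + 1) (h : homogeneousComponent (m + 1) p = 0) :
    p.totalDegree ≤ m := by
  rw [← sum_homogeneousComponent_of_le hp, Finset.sum_range_succ, h, add_zero]
  refine (totalDegree_finsetSum _ _).trans (Finset.sup_le fun k hk => ?_)
  exact (homogeneousComponent_isHomogeneous k p).totalDegree_le.trans
    (Finset.mem_range_succ_iff.mp hk)

/-! ### Non-negativity of small perturbations -/

/-- Asking for a whole interval of values of c, rather than one value, lets finitely many local
bounds be merged by taking their minimum. -/
theorem exists_uniform_perturbation {X : Type*} [TopologicalSpace X] {K : Set X}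
    (hK : IsCompact K) (F G : X → ℝ)
    (h : ∀ x ∈ K, ∃ c₀ > 0, ∀ᶠ y in 𝓝 x, ∀ c, 0 < c → c ≤ c₀ → 0 ≤ F y + c * G y) :
    ∃ c₀ > 0, ∀ y ∈ K, ∀ c, 0 < c → c ≤ c₀ → 0 ≤ F y + c * G y := by
  refine hK.induction_on (p := fun S => ∃ c₀ > 0, ∀ y ∈ S, ∀ c, 0 < c → c ≤ c₀ →
    0 ≤ F y + c * G y) ⟨1, one_pos, by simp⟩ ?_ ?_ ?_
  · rintro S T hST ⟨c₀, h0, hc⟩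
    exact ⟨c₀, h0, fun y hy => hc y (hST hy)⟩
  · rintro S T ⟨c₁, h1, hc1⟩ ⟨c₂, h2, hc2⟩
    refine ⟨min c₁ c₂, lt_min h1 h2, ?_⟩
    rintro y (hy | hy) c hc hle
    · exact hc1 y hy c hc (hle.trans (min_le_left _ _))
    · exact hc2 y hy c hc (hle.trans (min_le_right _ _))
  · intro x hx
    obtain ⟨c₀, h0, hc⟩ := h x hx
    exact ⟨_, mem_nhdsWithin_of_mem_nhds hc, c₀, h0, fun y hy => hy⟩

theorem eval_sub_taylor_isBigO {n : ℕ} (a : Fin n → ℝ) (p : MvPolynomial (Fin n) ℝ) :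
    (fun x => eval x p - eval a p - ∑ i, eval a (pderiv i p) * (x i - a i)) =O[𝓝 a]
      fun x => ‖x - a‖ ^ 2 := by
  have hcoord : ∀ i, (fun x : Fin n → ℝ => x i - a i) =O[𝓝 a] fun x => ‖x - a‖ := fun i =>
    Asymptotics.IsBigO.of_bound 1 (Eventually.of_forall fun x => by
      simpa using norm_le_pi_norm (x - a) i)
  induction p using MvPolynomial.induction_on with
  | C c => simpa using Asymptotics.isBigO_zero _ _
  | add p q hp hq =>
    refine (hp.add hq).congr_left fun x => ?_
    simp only [map_add, add_mul, Finset.sum_add_distrib]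
    ring
  | mul_X p i hp =>
    have h1 : (fun x : Fin n → ℝ => x i) =O[𝓝 a] fun _ => (1 : ℝ) :=
      (continuous_apply i).continuousAt.norm.isBoundedUnder_le.isBigO_one ℝ
    have h2 : (fun x : Fin n → ℝ => ∑ j, eval a (pderiv j p) * (x j - a j)) =O[𝓝 a]
        fun x => ‖x - a‖ :=
      Asymptotics.IsBigO.fun_sum fun j _ => (hcoord j).const_mul_left _
    refine (((hp.mul h1).congr_right fun x => mul_one _).add
      ((h2.mul (hcoord i)).congr_right fun x => (sq _).symm)).congr_left fun x => ?_
    have h3 : ∀ j, eval a (pderiv j (p * X i)) * (x j - a j) =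
        eval a (pderiv j p) * (x j - a j) * a i +
          if j = i then eval a p * (x i - a i) else 0 := by
      intro j
      rw [Derivation.leibniz, pderiv_X]
      by_cases hj : j = i
      · subst hj; simp; ring
      · simp [hj]; ring
    simp only [h3, Finset.sum_add_distrib, Finset.sum_ite_eq', Finset.mem_univ, if_true,
      ← Finset.sum_mul, map_mul, eval_X]
    ring

/-- Cauchy–Schwarz applied to the coefficients of `p` over `f`. -/
theorem exists_sq_le_of_mem_span {n s : ℕ} {f : Fin s → MvPolynomial (Fin n) ℝ}
    {p : MvPolynomial (Fin n) ℝ} (hp : p ∈ Submodule.span ℝ (Set.range f)) :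
    ∃ C, 0 ≤ C ∧ ∀ x, eval x p ^ 2 ≤ C * ∑ j, eval x (f j) ^ 2 := by
  obtain ⟨c, rfl⟩ := (Submodule.mem_span_range_iff_exists_fun ℝ).mp hp
  refine ⟨∑ j, c j ^ 2, Finset.sum_nonneg fun _ _ => sq_nonneg _, fun x => ?_⟩
  simpa [smul_eval] using Finset.sum_mul_sq_le_sq_mul_sq Finset.univ c fun j => eval x (f j)

/-- If the gradients at `a` of the members of the span of `f` exhaust the space, then `∑ f_j²`
dominates the square of the distance to `a`. -/
theorem norm_sq_isBigO_sum_sq {n s : ℕ} {f : Fin s → MvPolynomial (Fin n) ℝ} {a : Fin n → ℝ}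
    (ha : ∀ j, eval a (f j) = 0)
    (hfull : ∀ v : Fin n → ℝ, ∃ p ∈ Submodule.span ℝ (Set.range f),
      ∀ i, eval a (pderiv i p) = v i) :
    (fun x => ‖x - a‖ ^ 2) =O[𝓝 a] fun x => ∑ j, eval x (f j) ^ 2 := by
  choose p hp hgrad using fun i : Fin n => hfull (Pi.single i 1)
  have hpa : ∀ i, eval a (p i) = 0 := fun i => by
    obtain ⟨C, -, hC⟩ := exists_sq_le_of_mem_span (hp i)
    have := hC a
    simp only [ha, zero_pow two_ne_zero, Finset.sum_const_zero, mul_zero] at this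
    exact pow_eq_zero_iff two_ne_zero |>.mp (le_antisymm this (sq_nonneg _))
  choose C hC0 hC using fun i => exists_sq_le_of_mem_span (hp i)
  have htaylor : ∀ i, ∃ D, 0 ≤ D ∧
      ∀ᶠ x in 𝓝 a, |x i - a i| ≤ |eval x (p i)| + D * ‖x - a‖ ^ 2 := by
    intro i
    obtain ⟨D, hD0, hD⟩ := (eval_sub_taylor_isBigO a (p i)).exists_nonneg
    refine ⟨D, hD0, hD.bound.mono fun x hx => ?_⟩
    have h1 : ∑ j, eval a (pderiv j (p i)) * (x j - a j) = x i - a i := by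
      simp [hgrad, Pi.single_apply]
    rw [h1, hpa, Real.norm_eq_abs, Real.norm_eq_abs, abs_of_nonneg (sq_nonneg ‖x - a‖)] at hx
    have h2 : x i - a i = eval x (p i) - (eval x (p i) - 0 - (x i - a i)) := by ring
    calc |x i - a i| ≤ |eval x (p i)| + |eval x (p i) - 0 - (x i - a i)| := by
          conv_lhs => rw [h2]
          exact abs_sub _ _
      _ ≤ _ := by gcongr
  choose D hD0 hD using htaylor
  -- Close to `a` the quadratic Taylor error is at most half of ‖x - a‖, so it can be absorbed into
  -- the left side of `hbound`.
  have hsmall : ∀ᶠ x in 𝓝 a, (∑ i, D i) * ‖x - a‖ < 1 / 2 := by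
    have : Tendsto (fun x : Fin n → ℝ => (∑ i, D i) * ‖x - a‖) (𝓝 a) (𝓝 0) := by
      have h : Continuous fun x : Fin n → ℝ => (∑ i, D i) * ‖x - a‖ := by fun_prop
      simpa using h.tendsto a
    exact this.eventually (gt_mem_nhds (by norm_num))
  refine Asymptotics.IsBigO.of_bound (4 * ∑ i, C i) ?_
  filter_upwards [hsmall, eventually_all.mpr hD] with x hx hDx
  set S := ∑ j, eval x (f j) ^ 2 with hS
  have hS0 : 0 ≤ S := Finset.sum_nonneg fun _ _ => sq_nonneg _
  have hCS : 0 ≤ ∑ i, C i := Finset.sum_nonneg fun i _ => hC0 i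
  have hbound : ‖x - a‖ ≤ √((∑ i, C i) * S) + 1 / 2 * ‖x - a‖ := by
    refine (pi_norm_le_iff_of_nonneg (by positivity)).mpr fun i => ?_
    have h1 : |eval x (p i)| ≤ √((∑ i, C i) * S) := by
      refine Real.abs_le_sqrt ((hC i x).trans ?_)
      exact mul_le_mul_of_nonneg_right
        (Finset.single_le_sum (fun i _ => hC0 i) (Finset.mem_univ i)) hS0
    have h2 : D i * ‖x - a‖ ^ 2 ≤ 1 / 2 * ‖x - a‖ := by
      rw [sq, ← mul_assoc]
      refine mul_le_mul_of_nonneg_right (le_trans ?_ hx.le) (norm_nonneg _)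
      exact mul_le_mul_of_nonneg_right
        (Finset.single_le_sum (fun i _ => hD0 i) (Finset.mem_univ i)) (norm_nonneg _)
    exact (hDx i).trans (add_le_add h1 h2)
  have h4 : ‖x - a‖ ≤ 2 * √((∑ i, C i) * S) := by linarith
  rw [Real.norm_of_nonneg (sq_nonneg _), Real.norm_of_nonneg hS0]
  calc ‖x - a‖ ^ 2 ≤ (2 * √((∑ i, C i) * S)) ^ 2 := by gcongr
    _ = 4 * (∑ i, C i) * S := by rw [mul_pow, Real.sq_sqrt (by positivity)]; ring

/-- The analytic half of Hilbert's method, with the zeros at infinity included. -/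
theorem exists_isPsd_add {n d s : ℕ} {A : Set (Fin n → ℝ)}
    {f : Fin s → MvPolynomial (Fin n) ℝ} {g : MvPolynomial (Fin n) ℝ}
    (hf : ∀ j, f j ∈ vanishingSpace d A)
    (hfull : ∀ a ∈ A, ∀ v : Fin n → ℝ, ∃ p ∈ Submodule.span ℝ (Set.range f),
      ∀ i, eval a (pderiv i p) = v i)
    (hg : g ∈ singularSpace (2 * d) A)
    (hz : ∀ (y : Fin n → ℝ) (t : ℝ), (y, t) ≠ 0 → (∀ j, homEval d (y, t) (f j) = 0) →
      (t ≠ 0 ∧ t⁻¹ • y ∈ A) ∨ 0 < homEval (2 * d) (y, t) g) :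
    ∃ c₀ > 0, ∀ c, 0 < c → c ≤ c₀ → IsPsd (∑ j, f j ^ 2 + C c * g) := by
  have hfd : ∀ j, (f j).totalDegree ≤ d := fun j => (hf j).1
  set F : (Fin n → ℝ) × ℝ → ℝ := fun P => homEval (2 * d) P (∑ j, f j ^ 2) with hF
  set G : (Fin n → ℝ) × ℝ → ℝ := fun P => homEval (2 * d) P g with hG
  have hFc : Continuous F := continuous_homEval _ _
  have hGc : Continuous G := continuous_homEval _ _
  have hF0 : ∀ P, 0 ≤ F P := fun P => by
    simp only [hF, homEval_sum_sq hfd]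
    exact Finset.sum_nonneg fun _ _ => sq_nonneg _
  obtain ⟨c₀, h0, hc₀⟩ := exists_uniform_perturbation
    (isCompact_sphere (0 : (Fin n → ℝ) × ℝ) 1) F G (by
      rintro ⟨y, t⟩ hy
      have hne : (y, t) ≠ 0 := ne_zero_of_mem_unit_sphere ⟨_, hy⟩
      by_cases hpos : 0 < F (y, t)
      -- Near such a point F exceeds half its value and |G| stays below its value plus one; the
      -- quotient of the two is an admissible c₀.
      · refine ⟨F (y, t) / 2 / (|G (y, t)| + 1), by positivity, ?_⟩
        filter_upwards [hFc.continuousAt.eventually (lt_mem_nhds (half_lt_self hpos)),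
          hGc.abs.continuousAt.eventually (gt_mem_nhds (lt_add_one |G (y, t)|))] with z hz1 hz2
        intro c hc hle
        have h1 : c * |G z| ≤ F (y, t) / 2 := by
          rw [le_div_iff₀ (by positivity)] at hle
          exact (mul_le_mul_of_nonneg_left hz2.le hc.le).trans hle
        have h2 : -(c * |G z|) ≤ c * G z := by
          rw [← mul_neg]; exact mul_le_mul_of_nonneg_left (neg_abs_le _) hc.le
        linarith
      have hzero : ∀ j, homEval d (y, t) (f j) = 0 := by
        have h := le_antisymm (not_lt.mp hpos) (hF0 _)
        simp only [hF, homEval_sum_sq hfd] at h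
        rw [Finset.sum_eq_zero_iff_of_nonneg fun _ _ => sq_nonneg _] at h
        exact fun j => pow_eq_zero_iff two_ne_zero |>.mp (h j (Finset.mem_univ j))
      -- At a point of `A`, dehomogenize: `g` is O(dist²) and dist² is O(∑ f_j²), so `g` is O(∑
      -- f_j²) and c₀ is the inverse of the constant. The factor r ^ (2d) is positive because the
      -- degree is even.
      rcases hz y t hne hzero with ⟨ht, hA⟩ | hgpos
      · have h1 := norm_sq_isBigO_sum_sq (fun j => (hf j).2 _ hA) (hfull _ hA)
        have h2 := eval_sub_taylor_isBigO (t⁻¹ • y) g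
        simp only [(hg.2 _ hA).1, (hg.2 _ hA).2, zero_mul, Finset.sum_const_zero,
          sub_zero] at h2
        obtain ⟨D, hD, hb⟩ := (h2.trans h1).exists_pos
        refine ⟨D⁻¹, inv_pos.mpr hD, ?_⟩
        have hcont : ContinuousAt (fun P : (Fin n → ℝ) × ℝ => P.2⁻¹ • P.1) (y, t) :=
          ContinuousAt.smul (continuousAt_snd.inv₀ ht) continuousAt_fst
        filter_upwards [hcont.eventually hb.bound,
          continuousAt_snd.eventually (isOpen_ne.mem_nhds ht)] with z hz1 hz2
        intro c hc hle
        obtain ⟨z, r⟩ := z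
        have hr : 0 < r ^ (2 * d) := (even_two_mul d).pow_pos hz2
        simp only [hF, hG]
        rw [homEval_of_ne_zero (totalDegree_sum_sq_le hfd) z hz2,
          homEval_of_ne_zero hg.1 z hz2, eval_sum_sq]
        set S := ∑ j, eval (r⁻¹ • z) (f j) ^ 2
        have hS : 0 ≤ S := Finset.sum_nonneg fun _ _ => sq_nonneg _
        rw [Real.norm_eq_abs, Real.norm_of_nonneg hS] at hz1
        have h3 : c * |eval (r⁻¹ • z) g| ≤ S := by
          calc c * |eval (r⁻¹ • z) g| ≤ D⁻¹ * (D * S) := by gcongr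
            _ = S := by field_simp
        have h4 : -(c * |eval (r⁻¹ • z) g|) ≤ c * eval (r⁻¹ • z) g := by
          rw [← mul_neg]; exact mul_le_mul_of_nonneg_left (neg_abs_le _) hc.le
        have h5 : 0 ≤ r ^ (2 * d) * (S + c * eval (r⁻¹ • z) g) :=
          mul_nonneg hr.le (by linarith)
        linarith
      · refine ⟨1, one_pos, ?_⟩
        filter_upwards [hGc.continuousAt.eventually (lt_mem_nhds hgpos)] with z hz
        intro c hc _
        exact add_nonneg (hF0 z) (mul_nonneg hc.le hz.le))
  refine ⟨c₀, h0, fun c hc hle x => ?_⟩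
  have hne : ((x, 1) : (Fin n → ℝ) × ℝ) ≠ 0 := by simp [Prod.ext_iff]
  have hdeg : (∑ j, f j ^ 2 + C c * g).totalDegree ≤ 2 * d := by
    refine (totalDegree_add _ _).trans (max_le (totalDegree_sum_sq_le hfd) ?_)
    rw [C_mul']
    exact (totalDegree_smul_le _ _).trans hg.1
  have hlin : ∀ P, homEval (2 * d) P (∑ j, f j ^ 2 + C c * g) = F P + c * G P := fun P => by
    rw [map_add, C_mul', map_smul, smul_eq_mul]
  -- Scaling `(x, 1)` onto the sphere multiplies the homogenized value by a positive number, so its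
  -- sign is that of the value at `x`.
  have hmem : ‖((x, 1) : (Fin n → ℝ) × ℝ)‖⁻¹ • ((x, 1) : (Fin n → ℝ) × ℝ) ∈
      Metric.sphere (0 : (Fin n → ℝ) × ℝ) 1 := by
    rw [mem_sphere_zero_iff_norm, norm_smul, norm_inv, norm_norm,
      inv_mul_cancel₀ (norm_ne_zero_iff.mpr hne)]
  have h := hc₀ _ hmem c hc hle
  rw [← hlin, homEval_smul, homEval_one hdeg] at h
  exact nonneg_of_mul_nonneg_right h
    (pow_pos (inv_pos.mpr (norm_pos_iff.mpr hne)) _)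

/-! ### The obstruction to being a sum of squares -/

theorem exists_eq_sum_sq {n : ℕ} {p : MvPolynomial (Fin n) ℝ} (hp : IsSumSq p) :
    ∃ (s : ℕ) (h : Fin s → MvPolynomial (Fin n) ℝ), p = ∑ j, h j ^ 2 := by
  induction hp with
  | zero => exact ⟨0, Fin.elim0, by simp⟩
  | sq_add a _ ih =>
    obtain ⟨s, h, rfl⟩ := ih
    exact ⟨s + 1, Fin.cons a h, by simp [Fin.sum_univ_succ, sq]⟩

/-- Leading forms cannot cancel in a sum of real squares, so a common degree bound above d can be
lowered one step at a time. -/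
theorem totalDegree_le_of_sum_sq {n d s : ℕ} {h : Fin s → MvPolynomial (Fin n) ℝ}
    (hd : (∑ j, h j ^ 2).totalDegree ≤ 2 * d) (j : Fin s) : (h j).totalDegree ≤ d := by
  have key : ∀ k, (∀ j, (h j).totalDegree ≤ d + k) → ∀ j, (h j).totalDegree ≤ d := by
    intro k
    induction k with
    | zero => exact fun H => H
    | succ k ih =>
      intro H
      refine ih fun j => totalDegree_le_of_homogeneousComponent_eq_zero (H j) ?_
      refine MvPolynomial.funext fun x => ?_
      have h1 : homEval (2 * (d + (k + 1))) (x, 0) (∑ j, h j ^ 2) = 0 := by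
        rw [homEval_zero, homogeneousComponent_eq_zero _ _ (by omega), map_zero]
      rw [homEval_sum_sq H, Finset.sum_eq_zero_iff_of_nonneg fun _ _ => sq_nonneg _] at h1
      rw [map_zero, ← homEval_zero]
      exact pow_eq_zero_iff two_ne_zero |>.mp (h1 j (Finset.mem_univ j))
  exact key (∑ j, (h j).totalDegree) (fun j =>
    le_add_left (Finset.single_le_sum (f := fun j => (h j).totalDegree)
      (fun _ _ => Nat.zero_le _) (Finset.mem_univ j))) j

/-- At a zero of a sum of real squares every summand vanishes, so each polynomial squared is itself
in `vanishingSpace d A`. -/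
theorem mem_squareSpace_of_isSumSq {n d : ℕ} {A : Set (Fin n → ℝ)}
    {p : MvPolynomial (Fin n) ℝ} (hp : IsSumSq p) (hd : p.totalDegree ≤ 2 * d)
    (hA : ∀ a ∈ A, eval a p = 0) : p ∈ squareSpace d A := by
  obtain ⟨s, h, rfl⟩ := exists_eq_sum_sq hp
  refine Submodule.sum_mem _ fun j _ => ?_
  have hj : h j ∈ vanishingSpace d A := by
    refine ⟨totalDegree_le_of_sum_sq hd j, fun a ha => ?_⟩
    have := hA a ha
    rw [eval_sum_sq, Finset.sum_eq_zero_iff_of_nonneg fun _ _ => sq_nonneg _] at this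
    exact pow_eq_zero_iff two_ne_zero |>.mp (this j (Finset.mem_univ j))
  rw [sq]
  exact Submodule.mul_mem_mul hj hj

theorem not_isSumSq_add {n d s : ℕ} {A : Set (Fin n → ℝ)}
    {f : Fin s → MvPolynomial (Fin n) ℝ} {g : MvPolynomial (Fin n) ℝ}
    (hf : ∀ j, f j ∈ vanishingSpace d A) (hg : g ∈ singularSpace (2 * d) A)
    (hg' : g ∉ squareSpace d A) {c : ℝ} (hc : c ≠ 0) :
    ¬ IsSumSq (∑ j, f j ^ 2 + C c * g) := by
  intro h
  have h1 : ∑ j, f j ^ 2 ∈ squareSpace d A := Submodule.sum_mem _ fun j _ => by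
    rw [sq]; exact Submodule.mul_mem_mul (hf j) (hf j)
  have h2 := mem_squareSpace_of_isSumSq (d := d) (A := A) h
    ((totalDegree_add _ _).trans (max_le (totalDegree_sum_sq_le fun j => (hf j).1) (by
      rw [C_mul']; exact (totalDegree_smul_le _ _).trans hg.1)))
    (fun a ha => by simp [(hg.2 a ha).1, (hf _).2 a ha])
  rw [Submodule.add_mem_iff_right _ h1, C_mul', Submodule.smul_mem_iff _ hc] at h2
  exact hg' h2

theorem Hypotheses.exists_isPsd_not_isSumSq {n d s : ℕ} {A : Set (Fin n → ℝ)}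
    {f : Fin s → MvPolynomial (Fin n) ℝ} {g : MvPolynomial (Fin n) ℝ}
    (H : Hypotheses d A f g) :
    ∃ c : ℝ, 0 < c ∧ IsPsd (∑ j, f j ^ 2 + C c * g) ∧
      ¬ IsSumSq (∑ j, f j ^ 2 + C c * g) := by
  have hf : ∀ j, f j ∈ vanishingSpace d A := fun j =>
    H.span_eq ▸ Submodule.subset_span (Set.mem_range_self j)
  obtain ⟨c, hc, hpsd⟩ := exists_isPsd_add hf
    (fun a ha v => H.span_eq ▸ H.full a ha v) H.g_mem (by
      intro y t hne hzero
      by_cases ht : t = 0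
      · subst ht
        refine absurd ⟨fun hy => hne (by simp [hy]), ?_⟩ (H.no_zeros_at_infinity y)
        rw [← homEval_zero, homEval_sum_sq fun j => (hf j).1]
        simp [hzero]
      -- With infinity excluded, a common zero of the basis outside `A` is a forced zero, where `g`
      -- is positive by hypothesis.
      · by_cases hA : t⁻¹ • y ∈ A
        · exact Or.inl ⟨ht, hA⟩
        · right
          rw [homEval_of_ne_zero H.g_mem.1 y ht]
          refine mul_pos ((even_two_mul d).pow_pos ht) (H.g_pos _ ⟨fun p hp => ?_, hA⟩)
          rw [← H.span_eq] at hp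
          refine Submodule.span_induction ?_ (by simp) ?_ ?_ hp
          · rintro _ ⟨j, rfl⟩
            have := hzero j
            rw [homEval_of_ne_zero (hf j).1 y ht] at this
            exact (mul_eq_zero.mp this).resolve_left (pow_ne_zero _ ht)
          · intro p q _ _ hp hq
            simp [hp, hq]
          · intro a p _ hp
            simp [smul_eval, hp])
  exact ⟨c, hc, hpsd c hc le_rfl, not_isSumSq_add hf H.g_mem H.g_not_mem hc.ne'⟩

/-! ### Dimensions and conditions imposed by points -/

theorem finrank_restrictTotalDegree (m : ℕ) :
    2 * Module.finrank ℝ (restrictTotalDegree (Fin 2) ℝ m) = (m + 1) * (m + 2) := by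
  classical
  have h1 : Module.finrank ℝ (restrictTotalDegree (Fin 2) ℝ m) =
      Nat.card {d : Fin 2 →₀ ℕ | (d.sum fun _ e => e) ≤ m} :=
    Module.finrank_eq_nat_card_basis (basisRestrictSupport ℝ _)
  have e : {d : Fin 2 →₀ ℕ | (d.sum fun _ e => e) ≤ m} ≃
      (Finset.range (m + 1)).sigma fun k => Finset.range (m + 1 - k) :=
    { toFun := fun d => ⟨⟨d.1 0, d.1 1⟩, by
        have := d.2
        simp [Finsupp.sum_fintype, Fin.sum_univ_two] at this ⊢
        omega⟩
      invFun := fun k => ⟨Finsupp.equivFunOnFinite.symm ![k.1.1, k.1.2], by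
        have := k.2
        rw [Finset.mem_sigma, Finset.mem_range, Finset.mem_range] at this
        simp [Finsupp.sum_fintype, Fin.sum_univ_two] at this ⊢
        omega⟩
      left_inv := fun d => by
        ext i; fin_cases i <;> simp
      right_inv := fun k => by
        ext <;> simp }
  have h2 : ∀ m, (∑ k ∈ Finset.range (m + 1), (m + 1 - k)) * 2 = (m + 1) * (m + 2) := by
    intro m
    induction m with
    | zero => simp
    | succ m ih =>
      rw [Finset.sum_range_succ', add_mul,
        Finset.sum_congr rfl fun k _ => (by omega : m + 1 + 1 - (k + 1) = m + 1 - k), ih]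
      simp only [Nat.sub_zero]
      ring
  rw [h1, Nat.card_congr e, Nat.card_eq_fintype_card, Fintype.card_coe, Finset.card_sigma,
    mul_comm]
  simpa using h2 m

/-- Distinct points of the projective plane are separated by lines. -/
theorem exists_line {P Q : (Fin 2 → ℝ) × ℝ} (hP : P ≠ 0) (h : ∀ c : ℝ, c • P ≠ Q) :
    ∃ l : MvPolynomial (Fin 2) ℝ, l.totalDegree ≤ 1 ∧ homEval 1 P l = 0 ∧
      homEval 1 Q l ≠ 0 := by
  by_contra! H
  obtain ⟨x, t⟩ := P
  obtain ⟨y, s⟩ := Q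
  have hline : ∀ α β γ : ℝ, α * x 0 + β * x 1 + γ * t = 0 → α * y 0 + β * y 1 + γ * s = 0 := by
    intro α β γ h0
    have hdeg : (C α * X 0 + C β * X 1 + C γ : MvPolynomial (Fin 2) ℝ).totalDegree ≤ 1 := by
      have h : ∀ (a : ℝ) (i : Fin 2), (C a * X i : MvPolynomial (Fin 2) ℝ).totalDegree ≤ 1 :=
        fun a i => (isHomogeneous_C_mul_X a i).totalDegree_le
      refine (totalDegree_add _ _).trans (max_le ((totalDegree_add _ _).trans
        (max_le (h _ _) (h _ _))) (by simp))
    have hval : ∀ P : (Fin 2 → ℝ) × ℝ, homEval 1 P (C α * X 0 + C β * X 1 + C γ) =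
        α * P.1 0 + β * P.1 1 + γ * P.2 := fun P => by
      simp only [map_add, C_mul', map_smul, homEval_X, homEval_C, smul_eq_mul]
    have := H _ hdeg (by rw [hval]; exact h0)
    rwa [hval] at this
  -- These three lines through `P` say that the cross product of `P` and `Q` vanishes, so `Q` is a
  -- multiple of `P`.
  have e1 := hline (x 1) (-x 0) 0 (by ring)
  have e2 := hline t 0 (-x 0) (by ring)
  have e3 := hline 0 t (-x 1) (by ring)
  simp only [Prod.smul_mk, ne_eq, Prod.ext_iff, not_and, funext_iff, Fin.forall_fin_two,
    Pi.smul_apply, smul_eq_mul] at h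
  by_cases ht : t = 0
  · by_cases hx : x 0 = 0
    · by_cases hx1 : x 1 = 0
      · exact hP (Prod.ext (funext fun i => by fin_cases i <;> simp [*]) ht)
      · refine h (y 1 / x 1) ⟨?_, ?_⟩ ?_ <;> field_simp <;> simp_all
    · refine h (y 0 / x 0) ⟨?_, ?_⟩ ?_ <;> field_simp <;> simp_all <;> linarith
  · refine h (s / t) ⟨?_, ?_⟩ ?_ <;> field_simp <;> linarith

/-- A finset of representatives of distinct points of the projective plane. -/
structure IsPointSet (S : Finset ((Fin 2 → ℝ) × ℝ)) : Prop where
  ne_zero : ∀ P ∈ S, P ≠ 0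
  smul_ne : ∀ P ∈ S, ∀ Q ∈ S, P ≠ Q → ∀ c : ℝ, c • P ≠ Q

theorem totalDegree_finsetProd_le {ι : Type*} (s : Finset ι)
    {l : ι → MvPolynomial (Fin 2) ℝ} (hl : ∀ i ∈ s, (l i).totalDegree ≤ 1) :
    (∏ i ∈ s, l i).totalDegree ≤ s.card :=
  (totalDegree_finsetProd _ _).trans <| (Finset.sum_le_sum hl).trans (by simp)

theorem homEval_prod {ι : Type*} (s : Finset ι) (P : (Fin 2 → ℝ) × ℝ)
    {l : ι → MvPolynomial (Fin 2) ℝ} (hl : ∀ i ∈ s, (l i).totalDegree ≤ 1) :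
    homEval s.card P (∏ i ∈ s, l i) = ∏ i ∈ s, homEval 1 P (l i) := by
  classical
  induction s using Finset.induction_on with
  | empty => simp [homEval_apply]
  | insert a s ha ih =>
    have hs : ∀ i ∈ s, (l i).totalDegree ≤ 1 := fun i hi => hl i (Finset.mem_insert_of_mem hi)
    rw [Finset.prod_insert ha, Finset.prod_insert ha, Finset.card_insert_of_notMem ha, add_comm,
      homEval_mul (hl a (Finset.mem_insert_self a s)) (totalDegree_finsetProd_le s hs), ih hs]

/-- `n` points impose independent conditions on forms of degree at least `n - 1`. -/
theorem IsPointSet.exists_separating {S : Finset ((Fin 2 → ℝ) × ℝ)} (hS : IsPointSet S)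
    {m : ℕ} (hm : S.card ≤ m + 1) {Q : (Fin 2 → ℝ) × ℝ} (hQ : Q ∈ S) :
    ∃ p : MvPolynomial (Fin 2) ℝ, p.totalDegree ≤ m ∧ homEval m Q p = 1 ∧
      ∀ P ∈ S, P ≠ Q → homEval m P p = 0 := by
  classical
  have hline : ∀ P, ∃ l : MvPolynomial (Fin 2) ℝ, l.totalDegree ≤ 1 ∧
      (P ∈ S.erase Q → homEval 1 P l = 0) ∧ homEval 1 Q l ≠ 0 := by
    intro P
    by_cases hP : P ∈ S.erase Q
    · obtain ⟨hne, hP'⟩ := Finset.mem_erase.mp hP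
      obtain ⟨l, h1, h2, h3⟩ := exists_line (hS.ne_zero P hP') (hS.smul_ne P hP' Q hQ hne)
      exact ⟨l, h1, fun _ => h2, h3⟩
    -- Outside `S.erase Q`, notably at `Q` itself, only a line missing `Q` is needed. One is drawn
    -- through an auxiliary point: the origin if `Q` is at infinity, a point at infinity otherwise.
    · obtain ⟨l, h1, -, h3⟩ := exists_line (P := if Q.2 = 0 then (0, 1) else (1, 0)) (Q := Q)
        (by split_ifs <;> simp [Prod.ext_iff]) (by
          intro c hc
          split_ifs at hc with h
          · apply hS.ne_zero Q hQ
            rw [← hc] at h ⊢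
            simp at h
            simp [h]
          · rw [← hc] at h
            simp at h)
      exact ⟨l, h1, fun h => absurd h hP, h3⟩
  choose l hl1 hl2 hl3 using hline
  have hcard : (S.erase Q).card + 1 = S.card := Finset.card_erase_add_one hQ
  obtain ⟨k, hk⟩ : ∃ k, m = (S.erase Q).card + k := Nat.exists_eq_add_of_le (by omega)
  -- One line through each other point, padded up to degree `m` by powers of a line that misses `Q`.
  set p : MvPolynomial (Fin 2) ℝ := (∏ P ∈ S.erase Q, l P) * ∏ _i ∈ Finset.range k, l Q with hp
  have hd1 := totalDegree_finsetProd_le (S.erase Q) fun P _ => hl1 P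
  have hd2 : (∏ _i ∈ Finset.range k, l Q).totalDegree ≤ k := by
    simpa using totalDegree_finsetProd_le (Finset.range k) (l := fun _ => l Q) fun _ _ => hl1 Q
  have hval : ∀ P, homEval m P p =
      (∏ R ∈ S.erase Q, homEval 1 P (l R)) * homEval 1 P (l Q) ^ k := by
    intro P
    have h2 := homEval_prod (Finset.range k) P (l := fun _ => l Q) fun _ _ => hl1 Q
    rw [Finset.card_range, Finset.prod_const (homEval 1 P (l Q)), Finset.card_range] at h2
    rw [hk, homEval_mul hd1 hd2, homEval_prod _ _ fun P _ => hl1 P, h2]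
  have hQ0 : homEval m Q p ≠ 0 := by
    rw [hval]
    exact mul_ne_zero (Finset.prod_ne_zero_iff.mpr fun R _ => hl3 R) (pow_ne_zero _ (hl3 Q))
  refine ⟨(homEval m Q p)⁻¹ • p, (totalDegree_smul_le _ _).trans ?_, ?_, fun P hP hne => ?_⟩
  · rw [hk]
    exact (totalDegree_mul _ _).trans (add_le_add hd1 hd2)
  · rw [map_smul, smul_eq_mul, inv_mul_cancel₀ hQ0]
  · rw [map_smul, hval P, Finset.prod_eq_zero (Finset.mem_erase.mpr ⟨hne, hP⟩)
      (hl2 P (Finset.mem_erase.mpr ⟨hne, hP⟩))]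
    simp

/-- Evaluation of the forms of degree `m` at finitely many points. -/
noncomputable def evalOn (m : ℕ) (S : Finset ((Fin 2 → ℝ) × ℝ)) :
    restrictTotalDegree (Fin 2) ℝ m →ₗ[ℝ] (S → ℝ) :=
  LinearMap.pi fun P => homEval m P.1 ∘ₗ Submodule.subtype _

theorem IsPointSet.evalOn_surjective {S : Finset ((Fin 2 → ℝ) × ℝ)} (hS : IsPointSet S)
    {m : ℕ} (hm : S.card ≤ m + 1) : Function.Surjective (evalOn m S) := by
  classical
  intro y
  choose p hp1 hp2 hp3 using fun Q : S => hS.exists_separating hm Q.2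
  refine ⟨∑ Q : S, y Q • ⟨p Q, (mem_restrictTotalDegree _ _ _).mpr (hp1 Q)⟩, ?_⟩
  ext P
  rw [map_sum, Finset.sum_apply, Finset.sum_eq_single P]
  · simp [evalOn, hp2]
  · intro Q _ hQ
    simp [evalOn, hp3 Q P.1 P.2 (fun h => hQ (Subtype.ext h.symm))]
  · simp

theorem IsPointSet.finrank_ker_evalOn {S : Finset ((Fin 2 → ℝ) × ℝ)} (hS : IsPointSet S)
    {m : ℕ} (hm : S.card ≤ m + 1) :
    Module.finrank ℝ (LinearMap.ker (evalOn m S)) + S.card =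
      Module.finrank ℝ (restrictTotalDegree (Fin 2) ℝ m) := by
  have h := LinearMap.finrank_range_add_finrank_ker (evalOn m S)
  rw [LinearMap.range_eq_top.mpr (hS.evalOn_surjective hm), finrank_top,
    Module.finrank_fintype_fun_eq_card, Fintype.card_coe] at h
  omega

/-! ### Bezout's inequality and Noether's theorem in large degrees -/

/-- Multiplication by a polynomial of degree at most `a` on the polynomials of degree at most `k`. -/
noncomputable def mulOn {a k m : ℕ} (f : MvPolynomial (Fin 2) ℝ) (hf : f.totalDegree ≤ a)
    (hm : k + a = m) :
    restrictTotalDegree (Fin 2) ℝ k →ₗ[ℝ] restrictTotalDegree (Fin 2) ℝ m :=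
  (LinearMap.mulRight ℝ f).restrict fun p hp => by
    rw [mem_restrictTotalDegree] at hp ⊢
    exact (totalDegree_mul _ _).trans (hm ▸ add_le_add hp hf)

/-- The map `(u, w) ↦ u f₁ + w f₂` on polynomials of bounded degree. -/
noncomputable def combOn {a b : ℕ} (k : ℕ) {f₁ f₂ : MvPolynomial (Fin 2) ℝ}
    (ha : f₁.totalDegree = a) (hb : f₂.totalDegree = b) :
    restrictTotalDegree (Fin 2) ℝ (k + b) × restrictTotalDegree (Fin 2) ℝ (k + a) →ₗ[ℝ]
      restrictTotalDegree (Fin 2) ℝ (k + b + a) :=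
  (mulOn f₁ ha.le rfl).coprod (mulOn f₂ hb.le (Nat.add_right_comm k a b))

theorem exists_koszul {f₁ f₂ : MvPolynomial (Fin 2) ℝ} (h : IsRelPrime f₁ f₂) (h2 : f₂ ≠ 0)
    {u w : MvPolynomial (Fin 2) ℝ} (huw : u * f₁ + w * f₂ = 0) :
    ∃ e, u = e * f₂ ∧ w = -(e * f₁) ∧ (e ≠ 0 → e.totalDegree + f₂.totalDegree = u.totalDegree) := by
  have hdvd : f₂ ∣ u := h.symm.dvd_of_dvd_mul_right ⟨-w, by linear_combination huw⟩
  obtain ⟨e, rfl⟩ := hdvd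
  refine ⟨e, mul_comm _ _, ?_, fun he => ?_⟩
  · refine mul_left_cancel₀ h2 ?_
    linear_combination huw
  · rw [totalDegree_mul_of_isDomain h2 he, add_comm]

/-- The kernel consists of Koszul pairs (e f₂, -e f₁). Since f₂ has degree exactly b, such an e has
degree at most k, which bounds the dimension of the kernel. -/
theorem finrank_range_combOn {f₁ f₂ : MvPolynomial (Fin 2) ℝ} (h : IsRelPrime f₁ f₂)
    (h2 : f₂ ≠ 0) {a b k : ℕ} (ha : f₁.totalDegree = a) (hb : f₂.totalDegree = b) :
    Module.finrank ℝ (restrictTotalDegree (Fin 2) ℝ (k + b)) +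
      Module.finrank ℝ (restrictTotalDegree (Fin 2) ℝ (k + a)) ≤
    Module.finrank ℝ (LinearMap.range (combOn k ha hb)) +
      Module.finrank ℝ (restrictTotalDegree (Fin 2) ℝ k) := by
  have hker : LinearMap.ker (combOn k ha hb) ≤ LinearMap.range
      ((mulOn f₂ hb.le rfl : restrictTotalDegree (Fin 2) ℝ k →ₗ[ℝ] _).prod
        (-(mulOn f₁ ha.le rfl : restrictTotalDegree (Fin 2) ℝ k →ₗ[ℝ] _))) := by
    rintro ⟨⟨u, hu⟩, ⟨w, hw⟩⟩ huw
    have huw' : u * f₁ + w * f₂ = 0 := congrArg Subtype.val huw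
    obtain ⟨e, rfl, rfl, he⟩ := exists_koszul h h2 huw'
    have hek : e.totalDegree ≤ k := by
      by_cases h0 : e = 0
      · simp [h0]
      · have := he h0
        rw [mem_restrictTotalDegree] at hu
        omega
    refine ⟨⟨e, (mem_restrictTotalDegree _ _ _).mpr hek⟩, ?_⟩
    rfl
  have h3 := (Submodule.finrank_mono hker).trans (LinearMap.finrank_range_le _)
  have h4 := LinearMap.finrank_range_add_finrank_ker (combOn k ha hb)
  rw [Module.finrank_prod] at h4
  omega

theorem range_combOn_le_ker {f₁ f₂ : MvPolynomial (Fin 2) ℝ} {a b k : ℕ}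
    (ha : f₁.totalDegree = a) (hb : f₂.totalDegree = b) {S : Finset ((Fin 2 → ℝ) × ℝ)}
    (hz : ∀ P ∈ S, homEval a P f₁ = 0 ∧ homEval b P f₂ = 0) :
    LinearMap.range (combOn k ha hb) ≤ LinearMap.ker (evalOn (k + b + a) S) := by
  rintro _ ⟨⟨⟨u, hu⟩, ⟨w, hw⟩⟩, rfl⟩
  rw [mem_restrictTotalDegree] at hu hw
  rw [LinearMap.mem_ker]
  ext P
  have h1 : homEval (k + b + a) P.1 (u * f₁) = 0 := by
    rw [homEval_mul hu ha.le, (hz P.1 P.2).1, mul_zero]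
  have h2 : homEval (k + b + a) P.1 (w * f₂) = 0 := by
    rw [show k + b + a = (k + a) + b by omega, homEval_mul hw hb.le, (hz P.1 P.2).2, mul_zero]
  change homEval (k + b + a) P.1 (u * f₁ + w * f₂) = 0
  rw [map_add, h1, h2, add_zero]

/-- With `finrank_range_combOn`, this says that the combinations of f₁ and f₂ have codimension at
most ab. -/
theorem finrank_koszul (a b k : ℕ) :
    Module.finrank ℝ (restrictTotalDegree (Fin 2) ℝ (k + b + a)) +
      Module.finrank ℝ (restrictTotalDegree (Fin 2) ℝ k) =
    Module.finrank ℝ (restrictTotalDegree (Fin 2) ℝ (k + b)) +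
      Module.finrank ℝ (restrictTotalDegree (Fin 2) ℝ (k + a)) + a * b := by
  have h1 := finrank_restrictTotalDegree (k + b + a)
  have h2 := finrank_restrictTotalDegree k
  have h3 := finrank_restrictTotalDegree (k + b)
  have h4 := finrank_restrictTotalDegree (k + a)
  nlinarith

/-- Bezout's inequality for real points of the projective plane. -/
theorem IsPointSet.card_le {f₁ f₂ : MvPolynomial (Fin 2) ℝ} (h : IsRelPrime f₁ f₂)
    (h2 : f₂ ≠ 0) {a b : ℕ} (ha : f₁.totalDegree = a) (hb : f₂.totalDegree = b)
    {S : Finset ((Fin 2 → ℝ) × ℝ)} (hS : IsPointSet S)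
    (hz : ∀ P ∈ S, homEval a P f₁ = 0 ∧ homEval b P f₂ = 0) : S.card ≤ a * b := by
  -- In a degree this large the points impose independent conditions, so the kernel of evaluation
  -- has codimension `S.card` and contains a space of codimension at most ab.
  have e1 := hS.finrank_ker_evalOn (m := S.card + b + a) (by omega)
  have e2 := Submodule.finrank_mono (range_combOn_le_ker (k := S.card) ha hb hz)
  have e3 := finrank_range_combOn (k := S.card) h h2 ha hb
  have e4 := finrank_koszul a b S.card
  omega

/-- Noether's theorem in large degrees: if the number of common zeros is as large as Bezout's
inequality permits, the forms vanishing at them are combinations of the two given ones. -/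
theorem IsPointSet.exists_eq_of_vanish {f₁ f₂ : MvPolynomial (Fin 2) ℝ} (h : IsRelPrime f₁ f₂)
    (h2 : f₂ ≠ 0) {a b k : ℕ} (ha : f₁.totalDegree = a) (hb : f₂.totalDegree = b)
    {S : Finset ((Fin 2 → ℝ) × ℝ)} (hS : IsPointSet S)
    (hz : ∀ P ∈ S, homEval a P f₁ = 0 ∧ homEval b P f₂ = 0) (hcard : S.card = a * b)
    (hk : S.card ≤ k + b + a + 1) {g : MvPolynomial (Fin 2) ℝ}
    (hg : g.totalDegree ≤ k + b + a) (hgz : ∀ P ∈ S, homEval (k + b + a) P g = 0) :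
    ∃ u w : MvPolynomial (Fin 2) ℝ, u.totalDegree ≤ k + b ∧ w.totalDegree ≤ k + a ∧
      g = u * f₁ + w * f₂ := by
  have e1 := hS.finrank_ker_evalOn hk
  have e3 := finrank_range_combOn (k := k) h h2 ha hb
  have e4 := finrank_koszul a b k
  -- Both spaces now have codimension ab, so the inclusion is an equality.
  have e5 := Submodule.eq_of_le_of_finrank_le (range_combOn_le_ker (k := k) ha hb hz) (by omega)
  have hmem : (⟨g, (mem_restrictTotalDegree _ _ _).mpr hg⟩ :
      restrictTotalDegree (Fin 2) ℝ (k + b + a)) ∈ LinearMap.ker (evalOn (k + b + a) S) := by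
    rw [LinearMap.mem_ker]
    ext P
    exact hgz P.1 P.2
  rw [← e5] at hmem
  obtain ⟨⟨⟨u, hu⟩, ⟨w, hw⟩⟩, huw⟩ := hmem
  exact ⟨u, w, (mem_restrictTotalDegree _ _ _).mp hu, (mem_restrictTotalDegree _ _ _).mp hw,
    (congrArg Subtype.val huw).symm⟩

/-! ### Noether's theorem for cubics in every degree from 4 -/

theorem totalDegree_le_of_mul_le {f p : MvPolynomial (Fin 2) ℝ} {a k : ℕ} (hf : f ≠ 0)
    (ha : f.totalDegree = a) (h : (f * p).totalDegree ≤ k + a) : p.totalDegree ≤ k := by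
  by_cases hp : p = 0
  · simp [hp]
  · rw [totalDegree_mul_of_isDomain hf hp] at h
    omega

theorem homogeneousComponent_ne_zero {f : MvPolynomial (Fin 2) ℝ} {a : ℕ}
    (ha : f.totalDegree = a + 1) : homogeneousComponent (a + 1) f ≠ 0 := fun h => by
  have := totalDegree_le_of_homogeneousComponent_eq_zero ha.le h
  omega

theorem X_zero_dvd_of_mul_eq {p q : MvPolynomial (Fin 2) ℝ} (h : X 1 * p = X 0 * q) :
    (X 0 : MvPolynomial (Fin 2) ℝ) ∣ p := by
  refine ((X_prime (R := ℝ) (i := (0 : Fin 2))).dvd_or_dvd ⟨q, h⟩).resolve_left fun hd => ?_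
  rw [X_dvd_X] at hd
  exact absurd hd (by decide)

/-- In the coefficients `u`, `w` representing the degree `j + 4` polynomial `g` and its multiples
by the coordinates, the degrees can be lowered by one. -/
theorem exists_lower_coeff {f₁ f₂ : MvPolynomial (Fin 2) ℝ} (h : IsRelPrime f₁ f₂)
    (h1 : f₁.totalDegree = 3) (h2 : f₂.totalDegree = 3) {j : ℕ}
    {g : MvPolynomial (Fin 2) ℝ} (hg : g.totalDegree ≤ j + 4)
    {u w u₀ w₀ u₁ w₁ : MvPolynomial (Fin 2) ℝ}
    (hu : u.totalDegree ≤ j + 2) (hu₀ : u₀.totalDegree ≤ j + 2) (hu₁ : u₁.totalDegree ≤ j + 2)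
    (e : g = u * f₁ + w * f₂) (e₀ : X 0 * g = u₀ * f₁ + w₀ * f₂)
    (e₁ : X 1 * g = u₁ * f₁ + w₁ * f₂) :
    ∃ u w : MvPolynomial (Fin 2) ℝ, u.totalDegree ≤ j + 1 ∧ w.totalDegree ≤ j + 1 ∧
      g = u * f₁ + w * f₂ := by
  have hf2 : f₂ ≠ 0 := by rintro rfl; simp at h2
  have hX : ∀ i : Fin 2, (X i : MvPolynomial (Fin 2) ℝ).totalDegree ≤ 1 := fun i => by simp
  have hXc : ∀ i : Fin 2, homogeneousComponent 1 (X i : MvPolynomial (Fin 2) ℝ) = X i :=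
    fun i => homogeneousComponent_eq_self (isHomogeneous_X ℝ i)
  -- Comparing X i times the first representation with the second one shows that f₂ divides X i * u
  -- - u'. In degree j + 3 the term u' does not contribute, leaving a relation between top
  -- components.
  have key : ∀ (i : Fin 2) (u' w' : MvPolynomial (Fin 2) ℝ), u'.totalDegree ≤ j + 2 →
      X i * g = u' * f₁ + w' * f₂ → ∃ c : MvPolynomial (Fin 2) ℝ,
        X i * homogeneousComponent (j + 2) u =
          homogeneousComponent 3 f₂ * homogeneousComponent j c := by
    intro i u' w' hu' he'
    have hd : f₂ ∣ X i * u - u' := h.symm.dvd_of_dvd_mul_right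
      ⟨w' - X i * w, by linear_combination (-X i) * e + he'⟩
    obtain ⟨c, hc⟩ := hd
    have hXu : (X i * u).totalDegree ≤ 1 + (j + 2) :=
      (totalDegree_mul _ _).trans (add_le_add (hX i) hu)
    have hcd : c.totalDegree ≤ j := by
      refine totalDegree_le_of_mul_le hf2 h2 ?_
      rw [← hc]
      exact (totalDegree_sub _ _).trans (max_le (hXu.trans (by omega)) (by omega))
    refine ⟨c, ?_⟩
    rw [← homogeneousComponent_mul_of_le h2.le hcd, ← hc, map_sub, ← hXc i,
      ← homogeneousComponent_mul_of_le (hX i) hu, hXc i,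
      homogeneousComponent_eq_zero (3 + j) u' (by omega), sub_zero,
      show 3 + j = 1 + (j + 2) by omega]
  obtain ⟨c₀, hc₀⟩ := key 0 u₀ w₀ hu₀ e₀
  obtain ⟨c₁, hc₁⟩ := key 1 u₁ w₁ hu₁ e₁
  have hF2 := homogeneousComponent_ne_zero h2
  -- Eliminating u gives X 1 * C₀ = X 0 * C₁ for the degree-j components of c₀ and c₁. Hence X 0
  -- divides C₀, and the top component of u is a multiple of that of f₂.
  obtain ⟨r, hr⟩ := X_zero_dvd_of_mul_eq (p := homogeneousComponent j c₀)
    (q := homogeneousComponent j c₁) (mul_left_cancel₀ hF2 (by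
      linear_combination X 0 * hc₁ - X 1 * hc₀))
  have hT : homogeneousComponent (j + 2) u = homogeneousComponent 3 f₂ * r :=
    mul_left_cancel₀ (X_ne_zero 0) (by rw [hc₀, hr]; ring)
  have hXr : (X 0 * r : MvPolynomial (Fin 2) ℝ).totalDegree ≤ j :=
    hr ▸ (homogeneousComponent_isHomogeneous j c₀).totalDegree_le
  have hfr : (f₂ * r).totalDegree ≤ j + 2 ∧
      homogeneousComponent (j + 2) (f₂ * r) = homogeneousComponent 3 f₂ * r := by
    by_cases hr0 : r = 0
    · simp [hr0]
    · rw [totalDegree_mul_of_isDomain (X_ne_zero 0) hr0, totalDegree_X] at hXr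
      obtain ⟨i, rfl⟩ : ∃ i, j = 1 + i := Nat.exists_eq_add_of_le (by omega)
      have hri : r.totalDegree ≤ i := by omega
      have hrc : homogeneousComponent i r = r := by
        refine mul_left_cancel₀ (X_ne_zero (R := ℝ) (0 : Fin 2)) ?_
        rw [← hXc 0, ← homogeneousComponent_mul_of_le (hX 0) hri, hXc, ← hr]
        exact homogeneousComponent_eq_self (homogeneousComponent_isHomogeneous _ c₀)
      refine ⟨(totalDegree_mul _ _).trans (by omega), ?_⟩
      rw [show 1 + i + 2 = 3 + i by omega, homogeneousComponent_mul_of_le h2.le hri, hrc]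
  have hu' : (u - f₂ * r).totalDegree ≤ j + 1 := by
    refine totalDegree_le_of_homogeneousComponent_eq_zero
      ((totalDegree_sub _ _).trans (max_le hu hfr.1)) ?_
    rw [map_sub, hT, hfr.2, sub_self]
  -- Moving along the Koszul relation cancels the top component of u; the degree of the other
  -- coefficient is then forced.
  refine ⟨u - f₂ * r, w + r * f₁, hu', ?_, by rw [e]; ring⟩
  refine totalDegree_le_of_mul_le hf2 h2 ?_
  rw [show f₂ * (w + r * f₁) = g - (u - f₂ * r) * f₁ by rw [e]; ring]
  exact (totalDegree_sub _ _).trans (max_le hg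
    ((totalDegree_mul _ _).trans (by omega)))

/-- Noether's theorem for two cubics with nine distinct real common zeros. -/
theorem IsPointSet.exists_eq_of_cubics {f₁ f₂ : MvPolynomial (Fin 2) ℝ} (h : IsRelPrime f₁ f₂)
    (h1 : f₁.totalDegree = 3) (h2 : f₂.totalDegree = 3)
    {S : Finset ((Fin 2 → ℝ) × ℝ)} (hS : IsPointSet S) (hcard : S.card = 9)
    (hz : ∀ P ∈ S, homEval 3 P f₁ = 0 ∧ homEval 3 P f₂ = 0) (k : ℕ)
    {g : MvPolynomial (Fin 2) ℝ} (hg : g.totalDegree ≤ k + 4)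
    (hgz : ∀ P ∈ S, homEval (k + 4) P g = 0) :
    ∃ u w : MvPolynomial (Fin 2) ℝ, u.totalDegree ≤ k + 1 ∧ w.totalDegree ≤ k + 1 ∧
      g = u * f₁ + w * f₂ := by
  have hf2 : f₂ ≠ 0 := by rintro rfl; simp at h2
  have high : ∀ k, 4 ≤ k → ∀ g : MvPolynomial (Fin 2) ℝ, g.totalDegree ≤ k + 4 →
      (∀ P ∈ S, homEval (k + 4) P g = 0) →
      ∃ u w : MvPolynomial (Fin 2) ℝ, u.totalDegree ≤ k + 1 ∧ w.totalDegree ≤ k + 1 ∧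
      g = u * f₁ + w * f₂ := by
    intro k hk g hg hgz
    -- Nine points impose independent conditions from degree 8 on, which is k ≥ 4.
    obtain ⟨i, rfl⟩ : ∃ i, k = i + 2 := ⟨k - 2, by omega⟩
    exact hS.exists_eq_of_vanish h hf2 h1 h2 hz hcard (k := i) (by omega) hg hgz
  have down : ∀ i k, 4 ≤ k + i → ∀ g : MvPolynomial (Fin 2) ℝ, g.totalDegree ≤ k + 4 →
      (∀ P ∈ S, homEval (k + 4) P g = 0) →
      ∃ u w : MvPolynomial (Fin 2) ℝ, u.totalDegree ≤ k + 1 ∧ w.totalDegree ≤ k + 1 ∧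
      g = u * f₁ + w * f₂ := by
    intro i
    induction i with
    | zero => exact fun k hk => high k hk
    | succ i ih =>
      intro k hk g hg hgz
      -- Descent by one degree: the multiples of `g` by 1, X 0 and X 1 are the products of its
      -- homogenization with the three coordinates, and are covered by the next higher degree.
      have hmul : ∀ l : MvPolynomial (Fin 2) ℝ, l.totalDegree ≤ 1 →
          ∃ u w : MvPolynomial (Fin 2) ℝ, u.totalDegree ≤ k + 2 ∧ w.totalDegree ≤ k + 2 ∧
          l * g = u * f₁ + w * f₂ := by
        intro l hl
        refine ih (k + 1) (by omega) _ ((totalDegree_mul _ _).trans (by omega)) fun P hP => ?_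
        rw [show k + 1 + 4 = 1 + (k + 4) by omega, homEval_mul hl hg, hgz P hP, mul_zero]
      obtain ⟨u, w, hu, -, e⟩ := hmul 1 (by simp)
      obtain ⟨u₀, w₀, hu₀, -, e₀⟩ := hmul (X 0) (by simp)
      obtain ⟨u₁, w₁, hu₁, -, e₁⟩ := hmul (X 1) (by simp)
      rw [one_mul] at e
      exact exists_lower_coeff h h1 h2 hg hu hu₀ hu₁ e e₀ e₁
  exact down 4 k (by omega) g hg hgz

/-- A nontrivial relation would make u a nonzero multiple of the cubic f₂. -/
theorem eq_zero_of_comb_eq_zero {f₁ f₂ : MvPolynomial (Fin 2) ℝ} (h : IsRelPrime f₁ f₂)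
    (h2 : f₂.totalDegree = 3) {u w : MvPolynomial (Fin 2) ℝ}
    (hu : u.totalDegree ≤ 2) (huw : u * f₁ + w * f₂ = 0) : u = 0 ∧ w = 0 := by
  have hf2 : f₂ ≠ 0 := by rintro rfl; simp at h2
  obtain ⟨e, rfl, rfl, he⟩ := exists_koszul h hf2 huw
  have : e = 0 := by
    by_contra h0
    have := he h0
    omega
  simp [this]

/-! ### Eight affine points and a ninth projective point -/

theorem isRelPrime_of_totalDegree_eq_one {l l' : MvPolynomial (Fin 2) ℝ}
    (hl : l.totalDegree = 1) {x : Fin 2 → ℝ} (h : eval x l = 0) (h' : eval x l' ≠ 0) :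
    IsRelPrime l l' := by
  have hirr : Irreducible l := by
    refine irreducible_of_totalDegree_eq_one hl fun c hc => ?_
    have hl0 : l ≠ 0 := by rintro rfl; simp at hl
    obtain ⟨i, hi⟩ := MvPolynomial.ne_zero_iff.mp hl0
    exact isUnit_iff_ne_zero.mpr fun h0 => hi (by simpa [h0] using hc i)
  refine hirr.isRelPrime_iff_not_dvd.mpr ?_
  rintro ⟨k, rfl⟩
  simp [h] at h'

/-- Every point of the projective plane is the intersection of two lines. -/
theorem exists_two_lines {Q : (Fin 2 → ℝ) × ℝ} (hQ : Q ≠ 0) :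
    ∃ l l' : MvPolynomial (Fin 2) ℝ, l.totalDegree = 1 ∧ l'.totalDegree ≤ 1 ∧
      homEval 1 Q l = 0 ∧ homEval 1 Q l' = 0 ∧ IsRelPrime l l' := by
  obtain ⟨x, t⟩ := Q
  have hd : ∀ (i : Fin 2) (c : ℝ), (X i - C c : MvPolynomial (Fin 2) ℝ).totalDegree ≤ 1 :=
    fun i c => (totalDegree_sub_C_le _ _).trans (by simp)
  have hne : ∀ {l : MvPolynomial (Fin 2) ℝ}, l.totalDegree ≤ 1 →
      ∀ y z, eval y l ≠ eval z l → l.totalDegree = 1 := by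
    intro l hl y z hyz
    refine le_antisymm hl (Nat.one_le_iff_ne_zero.mpr fun h0 => hyz ?_)
    rw [totalDegree_eq_zero_iff_eq_C.mp h0, eval_C, eval_C]
  by_cases ht : t = 0
  · subst ht
    have hline : (C (x 1) * X 0 - C (x 0) * X 1 : MvPolynomial (Fin 2) ℝ).totalDegree ≤ 1 :=
      (totalDegree_sub _ _).trans (max_le (isHomogeneous_C_mul_X _ _).totalDegree_le
        (isHomogeneous_C_mul_X _ _).totalDegree_le)
    -- Homogenized to degree 1, the constant 1 is the line at infinity, which passes through `Q`.
    refine ⟨C (x 1) * X 0 - C (x 0) * X 1, 1, hne hline 0 ![x 1, -x 0] ?_, by simp, ?_, ?_,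
      isRelPrime_one_right⟩
    · intro h
      simp only [map_sub, map_mul, eval_C, eval_X, Pi.zero_apply, Matrix.cons_val_zero,
        Matrix.cons_val_one] at h
      have h0 : x 0 = 0 := by nlinarith [sq_nonneg (x 0), sq_nonneg (x 1)]
      have h1 : x 1 = 0 := by nlinarith [sq_nonneg (x 0), sq_nonneg (x 1)]
      exact hQ (Prod.ext (funext fun i => by fin_cases i <;> simp [h0, h1]) rfl)
    · simp only [map_sub, C_mul', map_smul, homEval_X, smul_eq_mul]
      ring
    · simpa using homEval_C (1 : ℝ) (x, 0)
  · have hval : ∀ i : Fin 2, homEval 1 (x, t) (X i - C (x i / t)) = 0 := fun i => by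
      rw [map_sub, homEval_X, homEval_C]
      field_simp
      simp
    refine ⟨X 0 - C (x 0 / t), X 1 - C (x 1 / t),
      hne (hd _ _) ![x 0 / t, 0] ![x 0 / t + 1, 0] (by simp), hd _ _, hval 0, hval 1, ?_⟩
    exact isRelPrime_of_totalDegree_eq_one
      (hne (hd _ _) ![x 0 / t, 0] ![x 0 / t + 1, 0] (by simp)) (x := ![x 0 / t, x 1 / t + 1])
      (by simp) (by simp)

open Classical in
/-- The projective points consisting of the affine points `A` and a further point `Q`. -/
noncomputable def pointSet (A : Finset (Fin 2 → ℝ)) (Q : (Fin 2 → ℝ) × ℝ) :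
    Finset ((Fin 2 → ℝ) × ℝ) :=
  insert Q (A.image fun a => (a, 1))

theorem mem_pointSet {A : Finset (Fin 2 → ℝ)} {P Q : (Fin 2 → ℝ) × ℝ} :
    P ∈ pointSet A Q ↔ P = Q ∨ ∃ a ∈ A, (a, 1) = P := by
  simp [pointSet]

theorem card_pointSet {A : Finset (Fin 2 → ℝ)} {Q : (Fin 2 → ℝ) × ℝ}
    (hQ : ∀ a ∈ A, (a, 1) ≠ Q) : (pointSet A Q).card = A.card + 1 := by
  classical
  rw [pointSet, Finset.card_insert_of_notMem (by simpa using hQ),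
    Finset.card_image_of_injective _ fun a b h => (Prod.ext_iff.mp h).1]

theorem IsPointSet.insert [DecidableEq ((Fin 2 → ℝ) × ℝ)] {S : Finset ((Fin 2 → ℝ) × ℝ)}
    (hS : IsPointSet S) {P : (Fin 2 → ℝ) × ℝ} (hP : P ≠ 0)
    (h : ∀ R ∈ S, ∀ c : ℝ, c • R ≠ P) : IsPointSet (insert P S) := by
  refine ⟨by simpa [hP] using hS.ne_zero, fun R hR R' hR' hne c hc => ?_⟩
  rcases Finset.mem_insert.mp hR with rfl | hRS
  · rcases Finset.mem_insert.mp hR' with rfl | hRS'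
    · exact hne rfl
    · have hc0 : c ≠ 0 := by
        rintro rfl
        exact hS.ne_zero _ hRS' (by rw [← hc, zero_smul])
      exact h _ hRS' c⁻¹ (by rw [← hc, smul_smul, inv_mul_cancel₀ hc0, one_smul])
  · rcases Finset.mem_insert.mp hR' with rfl | hRS'
    · exact h _ hRS c hc
    · exact hS.smul_ne _ hRS _ hRS' hne c hc

theorem isPointSet_image [DecidableEq ((Fin 2 → ℝ) × ℝ)] (A : Finset (Fin 2 → ℝ)) :
    IsPointSet (A.image fun a => (a, (1 : ℝ))) := by
  refine ⟨?_, ?_⟩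
  · simp only [Finset.forall_mem_image]
    intro a _ h
    simpa using congrArg Prod.snd h
  · simp only [Finset.forall_mem_image]
    intro a _ b _ hne c hc
    rw [Prod.smul_mk, Prod.mk.injEq, smul_eq_mul, mul_one] at hc
    obtain ⟨h1, rfl⟩ := hc
    exact hne (by rw [← h1, one_smul])

theorem isPointSet_pointSet {A : Finset (Fin 2 → ℝ)} {Q : (Fin 2 → ℝ) × ℝ} (hQ : Q ≠ 0)
    (h : ∀ a ∈ A, ∀ c : ℝ, (c • a, c) ≠ Q) : IsPointSet (pointSet A Q) := by
  classical
  have := (isPointSet_image A).insert hQ (by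
    simp only [Finset.forall_mem_image, Prod.smul_mk, smul_eq_mul, mul_one]
    exact h)
  unfold pointSet
  convert this

/-- Two relatively prime cubics whose common zeros in the projective plane include eight affine
points `A` and a ninth point `Q`. -/
structure IsCubicPair (f₁ f₂ : MvPolynomial (Fin 2) ℝ) (A : Finset (Fin 2 → ℝ))
    (Q : (Fin 2 → ℝ) × ℝ) : Prop where
  isRelPrime : IsRelPrime f₁ f₂
  degree_fst : f₁.totalDegree = 3
  degree_snd : f₂.totalDegree = 3
  card_eq : A.card = 8
  ne_zero : Q ≠ 0
  smul_ne : ∀ a ∈ A, ∀ c : ℝ, (c • a, c) ≠ Q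
  zeros_fst : ∀ a ∈ A, eval a f₁ = 0
  zeros_snd : ∀ a ∈ A, eval a f₂ = 0
  zero_fst : homEval 3 Q f₁ = 0
  zero_snd : homEval 3 Q f₂ = 0

namespace IsCubicPair

variable {f₁ f₂ : MvPolynomial (Fin 2) ℝ} {A : Finset (Fin 2 → ℝ)} {Q : (Fin 2 → ℝ) × ℝ}

theorem isPointSet (H : IsCubicPair f₁ f₂ A Q) : IsPointSet (pointSet A Q) :=
  isPointSet_pointSet H.ne_zero H.smul_ne

theorem card_pointSet (H : IsCubicPair f₁ f₂ A Q) : (pointSet A Q).card = 9 := by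
  rw [HilbertMethod.card_pointSet fun a ha => by simpa using H.smul_ne a ha 1, H.card_eq]

theorem zeros (H : IsCubicPair f₁ f₂ A Q) :
    ∀ P ∈ pointSet A Q, homEval 3 P f₁ = 0 ∧ homEval 3 P f₂ = 0 := by
  intro P hP
  rcases mem_pointSet.mp hP with rfl | ⟨a, ha, rfl⟩
  · exact ⟨H.zero_fst, H.zero_snd⟩
  · rw [homEval_one H.degree_fst.le, homEval_one H.degree_snd.le]
    exact ⟨H.zeros_fst a ha, H.zeros_snd a ha⟩

theorem fst_mem (H : IsCubicPair f₁ f₂ A Q) : f₁ ∈ vanishingSpace 3 (A : Set (Fin 2 → ℝ)) :=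
  ⟨H.degree_fst.le, H.zeros_fst⟩

theorem snd_mem (H : IsCubicPair f₁ f₂ A Q) : f₂ ∈ vanishingSpace 3 (A : Set (Fin 2 → ℝ)) :=
  ⟨H.degree_snd.le, H.zeros_snd⟩

/-- A tenth common zero would violate Bezout's inequality. -/
theorem exists_smul_eq (H : IsCubicPair f₁ f₂ A Q) {P : (Fin 2 → ℝ) × ℝ} (hP : P ≠ 0)
    (h1 : homEval 3 P f₁ = 0) (h2 : homEval 3 P f₂ = 0) :
    ∃ R ∈ pointSet A Q, ∃ c : ℝ, c • R = P := by
  classical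
  by_contra! h
  have hnot : P ∉ pointSet A Q := fun hmem => h P hmem 1 (one_smul _ _)
  have hf2 : f₂ ≠ 0 := by
    rintro rfl
    simpa using H.degree_snd
  have := (H.isPointSet.insert hP h).card_le H.isRelPrime hf2 H.degree_fst H.degree_snd (by
    intro R hR
    rcases Finset.mem_insert.mp hR with rfl | hR
    · exact ⟨h1, h2⟩
    · exact H.zeros R hR)
  rw [Finset.card_insert_of_notMem hnot, H.card_pointSet] at this
  omega

/-- The theorem of Cayley and Bacharach. -/
theorem exists_eq_of_mem (H : IsCubicPair f₁ f₂ A Q) {p : MvPolynomial (Fin 2) ℝ}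
    (hp : p ∈ vanishingSpace 3 (A : Set (Fin 2 → ℝ))) :
    ∃ α β : ℝ, p = C α * f₁ + C β * f₂ := by
  -- Noether's theorem is available only from degree 4 and needs vanishing at `Q` too; multiplying p
  -- by a line through `Q` secures both.
  obtain ⟨l, l', hl, hl', hlQ, hlQ', hrel⟩ := exists_two_lines H.ne_zero
  have hl0 : l ≠ 0 := by rintro rfl; simp at hl
  have key : ∀ l : MvPolynomial (Fin 2) ℝ, l.totalDegree ≤ 1 → homEval 1 Q l = 0 →
      ∃ u w : MvPolynomial (Fin 2) ℝ, u.totalDegree ≤ 1 ∧ w.totalDegree ≤ 1 ∧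
        l * p = u * f₁ + w * f₂ := by
    intro l hl hlQ
    refine H.isPointSet.exists_eq_of_cubics H.isRelPrime H.degree_fst H.degree_snd
      H.card_pointSet H.zeros 0 ((totalDegree_mul _ _).trans
        ((add_le_add hl hp.1).trans (by norm_num))) ?_
    intro P hP
    rw [show 0 + 4 = 1 + 3 by rfl, homEval_mul hl hp.1]
    rcases mem_pointSet.mp hP with rfl | ⟨a, ha, rfl⟩
    · rw [hlQ, zero_mul]
    · rw [homEval_one hp.1, hp.2 a ha, mul_zero]
  obtain ⟨u, w, hu, hw, e⟩ := key l hl.le hlQ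
  obtain ⟨u', w', hu', -, e'⟩ := key l' hl' hlQ'
  obtain ⟨h1, h2⟩ := eq_zero_of_comb_eq_zero H.isRelPrime H.degree_snd
    (u := l' * u - l * u') (w := l' * w - l * w')
    ((totalDegree_sub _ _).trans (max_le ((totalDegree_mul _ _).trans (by omega))
      ((totalDegree_mul _ _).trans (by omega)))) (by linear_combination l * e' - l' * e)
  have hconst : ∀ u u' : MvPolynomial (Fin 2) ℝ, u.totalDegree ≤ 1 → l' * u - l * u' = 0 →
      ∃ α : ℝ, u = l * C α := by
    intro u u' hu h
    obtain ⟨r, rfl⟩ : l ∣ u := hrel.dvd_of_dvd_mul_left ⟨u', by linear_combination h⟩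
    have hr : r.totalDegree ≤ 0 := totalDegree_le_of_mul_le hl0 hl (by simpa using hu)
    exact ⟨_, by rw [← totalDegree_eq_zero_iff_eq_C.mp (Nat.le_zero.mp hr)]⟩
  obtain ⟨α, rfl⟩ := hconst u u' hu h1
  obtain ⟨β, rfl⟩ := hconst w w' hw h2
  exact ⟨α, β, mul_left_cancel₀ hl0 (by rw [e]; ring)⟩

theorem span_eq (H : IsCubicPair f₁ f₂ A Q) :
    Submodule.span ℝ (Set.range ![f₁, f₂]) = vanishingSpace 3 (A : Set (Fin 2 → ℝ)) := by
  rw [Matrix.range_cons, Matrix.range_cons, Matrix.range_empty, Set.union_empty]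
  refine le_antisymm (Submodule.span_le.mpr ?_) fun p hp => ?_
  · rintro _ (rfl | rfl)
    exacts [H.fst_mem, H.snd_mem]
  · obtain ⟨α, β, rfl⟩ := H.exists_eq_of_mem hp
    rw [C_mul', C_mul']
    exact Submodule.add_mem _ (Submodule.smul_mem _ _ (Submodule.subset_span (by simp)))
      (Submodule.smul_mem _ _ (Submodule.subset_span (by simp)))

/-- The two cubics meet transversally. -/
theorem exists_gradient (H : IsCubicPair f₁ f₂ A Q) {a : Fin 2 → ℝ} (ha : a ∈ A)
    (v : Fin 2 → ℝ) :
    ∃ α β : ℝ, ∀ i, α * eval a (pderiv i f₁) + β * eval a (pderiv i f₂) = v i := by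
  have hmem : (a, (1 : ℝ)) ∈ pointSet A Q := mem_pointSet.mpr (Or.inr ⟨a, ha, rfl⟩)
  obtain ⟨p, hp, hpa, hpz⟩ := H.isPointSet.exists_separating (m := 8)
    (by rw [H.card_pointSet]) hmem
  set l : MvPolynomial (Fin 2) ℝ := ∑ i, C (v i) * (X i - C (a i)) with hl
  have hld : l.totalDegree ≤ 1 := by
    refine (totalDegree_finsetSum _ _).trans (Finset.sup_le fun i _ => ?_)
    refine (totalDegree_mul _ _).trans ?_
    rw [totalDegree_C, zero_add]
    exact (totalDegree_sub_C_le _ _).trans (by simp)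
  have hla : eval a l = 0 := by simp [hl]
  have hlg : ∀ i, eval a (pderiv i l) = v i := by
    intro i
    fin_cases i <;> simp [hl, Fin.sum_univ_two, pderiv_X]
  -- `l * p` vanishes at all nine points and has gradient v at `a`, where p = 1 and l = 0.
  -- Differentiating its representation at `a` gives the coefficients u(a), w(a).
  obtain ⟨u, w, -, -, e⟩ := H.isPointSet.exists_eq_of_cubics H.isRelPrime H.degree_fst
    H.degree_snd H.card_pointSet H.zeros 5 (g := l * p)
    ((totalDegree_mul _ _).trans ((add_le_add hld hp).trans (by norm_num))) (by
      intro P hP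
      rw [show 5 + 4 = 1 + 8 by rfl, homEval_mul hld hp]
      by_cases h : P = (a, 1)
      · rw [h, homEval_one hld, hla, zero_mul]
      · rw [hpz P hP h, mul_zero])
  rw [homEval_one hp] at hpa
  refine ⟨eval a u, eval a w, fun i => ?_⟩
  have := congrArg (fun q => eval a (pderiv i q)) e
  simp only [Derivation.leibniz, map_add, smul_eq_mul, map_mul, hla, hlg, hpa,
    H.zeros_fst a ha, H.zeros_snd a ha] at this
  linarith

theorem isFull (H : IsCubicPair f₁ f₂ A Q) : IsFull 3 (A : Set (Fin 2 → ℝ)) := by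
  intro a ha v
  obtain ⟨α, β, h⟩ := H.exists_gradient ha v
  refine ⟨α • f₁ + β • f₂, Submodule.add_mem _ (Submodule.smul_mem _ _ H.fst_mem)
    (Submodule.smul_mem _ _ H.snd_mem), fun i => ?_⟩
  rw [← h i]
  simp [smul_eval]

/-- The two gradients span the plane, so their determinant is nonzero and they are independent. -/
theorem eq_zero_of_gradient (H : IsCubicPair f₁ f₂ A Q) {a : Fin 2 → ℝ} (ha : a ∈ A)
    {α β : ℝ} (h : ∀ i, α * eval a (pderiv i f₁) + β * eval a (pderiv i f₂) = 0) :
    α = 0 ∧ β = 0 := by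
  obtain ⟨s, t, hst⟩ := H.exists_gradient ha ![1, 0]
  obtain ⟨s', t', hst'⟩ := H.exists_gradient ha ![0, 1]
  have e1 := hst 0
  have e2 := hst 1
  have e3 := hst' 0
  have e4 := hst' 1
  have h0 := h 0
  have h1 := h 1
  simp only [Matrix.cons_val_zero, Matrix.cons_val_one] at e1 e2 e3 e4
  generalize eval a (pderiv 0 f₁) = p at *
  generalize eval a (pderiv 1 f₁) = q at *
  generalize eval a (pderiv 0 f₂) = r at *
  generalize eval a (pderiv 1 f₂) = z at *
  have hdet : (s * t' - t * s') * (p * z - q * r) = 1 := by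
    linear_combination e1 * (s' * q + t' * z) + e4 - e2 * (s' * p + t' * r)
  have hne : p * z - q * r ≠ 0 := by
    intro h; rw [h, mul_zero] at hdet; exact zero_ne_one hdet
  constructor
  · exact (mul_eq_zero.mp (by linear_combination z * h0 - r * h1 :
      α * (p * z - q * r) = 0)).resolve_right hne
  · exact (mul_eq_zero.mp (by linear_combination p * h1 - q * h0 :
      β * (p * z - q * r) = 0)).resolve_right hne

/-- Noether's theorem gives g = u f₁ + w f₂ with cubic coefficients. The vanishing gradient of g on
`A`, with transversality, forces u and w to vanish there. -/
theorem mem_squareSpace_of_homEval_eq_zero (H : IsCubicPair f₁ f₂ A Q)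
    {g : MvPolynomial (Fin 2) ℝ} (hg : g ∈ singularSpace 6 (A : Set (Fin 2 → ℝ)))
    (hQ : homEval 6 Q g = 0) : g ∈ squareSpace 3 (A : Set (Fin 2 → ℝ)) := by
  obtain ⟨u, w, hu, hw, rfl⟩ := H.isPointSet.exists_eq_of_cubics H.isRelPrime H.degree_fst
    H.degree_snd H.card_pointSet H.zeros 2 hg.1 (by
      intro P hP
      rcases mem_pointSet.mp hP with rfl | ⟨a, ha, rfl⟩
      · exact hQ
      · rw [homEval_one hg.1]; exact (hg.2 a ha).1)
  have hvan : ∀ a ∈ A, eval a u = 0 ∧ eval a w = 0 := by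
    intro a ha
    refine H.eq_zero_of_gradient ha fun i => ?_
    have := (hg.2 a ha).2 i
    simp only [Derivation.leibniz, map_add, smul_eq_mul, map_mul,
      H.zeros_fst a ha, H.zeros_snd a ha] at this
    linarith
  exact Submodule.add_mem _
    (Submodule.mul_mem_mul ⟨hu, fun a ha => (hvan a ha).1⟩ H.fst_mem)
    (Submodule.mul_mem_mul ⟨hw, fun a ha => (hvan a ha).2⟩ H.snd_mem)

theorem squareSpace_le (H : IsCubicPair f₁ f₂ A Q) :
    squareSpace 3 (A : Set (Fin 2 → ℝ)) ≤
      Submodule.span ℝ (Set.range ![f₁ * f₁, f₁ * f₂, f₂ * f₂]) := by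
  refine Submodule.mul_le.mpr fun p hp q hq => ?_
  obtain ⟨α, β, rfl⟩ := H.exists_eq_of_mem hp
  obtain ⟨γ, δ, rfl⟩ := H.exists_eq_of_mem hq
  refine (Submodule.mem_span_range_iff_exists_fun ℝ).mpr
    ⟨![α * γ, α * δ + β * γ, β * δ], ?_⟩
  simp only [Fin.sum_univ_three, Matrix.cons_val, ← C_mul', map_add, map_mul]
  ring

/-- Sextics have dimension 28, being singular at eight points costs at most 24, and `squareSpace 3
A` has dimension at most 3. -/
theorem exists_singular_notMem (H : IsCubicPair f₁ f₂ A Q) :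
    ∃ g ∈ singularSpace 6 (A : Set (Fin 2 → ℝ)), g ∉ squareSpace 3 (A : Set (Fin 2 → ℝ)) := by
  by_contra! h
  let Φ : restrictTotalDegree (Fin 2) ℝ 6 →ₗ[ℝ] (A → ℝ × (Fin 2 → ℝ)) :=
    (LinearMap.pi fun a : A => (aeval a.1).toLinearMap.prod
      (LinearMap.pi fun i => (aeval a.1).toLinearMap ∘ₗ (pderiv i).toLinearMap)) ∘ₗ
      Submodule.subtype _
  have hle : (LinearMap.ker Φ).map (Submodule.subtype _) ≤
      Submodule.span ℝ (Set.range ![f₁ * f₁, f₁ * f₂, f₂ * f₂]) := by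
    rintro _ ⟨⟨g, hg⟩, hker, rfl⟩
    refine H.squareSpace_le (h g ⟨(mem_restrictTotalDegree _ _ _).mp hg, fun a ha => ?_⟩)
    have h1 := congrFun (LinearMap.mem_ker.mp hker) ⟨a, ha⟩
    exact ⟨congrArg Prod.fst h1, fun i => congrFun (congrArg Prod.snd h1) i⟩
  have : Module.Finite ℝ (Submodule.span ℝ (Set.range ![f₁ * f₁, f₁ * f₂, f₂ * f₂])) :=
    Module.Finite.span_of_finite ℝ (Set.finite_range _)
  have h1 := Submodule.finrank_mono hle
  have h2 := finrank_range_le_card (R := ℝ) ![f₁ * f₁, f₁ * f₂, f₂ * f₂]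
  have h3 := LinearMap.finrank_range_add_finrank_ker Φ
  have h4 := Submodule.finrank_le (LinearMap.range Φ)
  have h5 := finrank_restrictTotalDegree 6
  rw [Module.finrank_pi_fintype] at h4
  simp only [Module.finrank_prod, Module.finrank_self, Module.finrank_fintype_fun_eq_card,
    Fintype.card_fin, Finset.sum_const, Finset.card_univ, Fintype.card_coe, H.card_eq,
    smul_eq_mul] at h4
  rw [Submodule.finrank_map_subtype_eq] at h1
  simp only [Fintype.card_fin, Set.finrank] at h2
  omega

theorem exists_perturbation (H : IsCubicPair f₁ f₂ A Q) :
    ∃ g ∈ singularSpace 6 (A : Set (Fin 2 → ℝ)),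
      g ∉ squareSpace 3 (A : Set (Fin 2 → ℝ)) ∧ 0 < homEval 6 Q g := by
  obtain ⟨g, hg, hg'⟩ := H.exists_singular_notMem
  rcases lt_trichotomy (homEval 6 Q g) 0 with h | h | h
  · exact ⟨-g, Submodule.neg_mem _ hg, fun h => hg' (by simpa using Submodule.neg_mem _ h),
      by rw [map_neg]; linarith⟩
  · exact absurd (H.mem_squareSpace_of_homEval_eq_zero hg h) hg'
  · exact ⟨g, hg, hg', h⟩

theorem hasPsdNotSosSextic (H : IsCubicPair f₁ f₂ A Q) :
    HasPsdNotSosSextic (A : Set (Fin 2 → ℝ)) := by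
  obtain ⟨g, hg, hg', hgQ⟩ := H.exists_perturbation
  have hf : ∀ j, ![f₁, f₂] j ∈ vanishingSpace 3 (A : Set (Fin 2 → ℝ)) := fun j => by
    fin_cases j
    exacts [H.fst_mem, H.snd_mem]
  obtain ⟨c, hc, hpsd⟩ := exists_isPsd_add (d := 3) hf
    (fun a ha v => H.span_eq ▸ H.isFull a ha v) hg (by
      intro y t hne hzero
      obtain ⟨R, hR, s, hs⟩ := H.exists_smul_eq hne (hzero 0) (hzero 1)
      have hs0 : s ≠ 0 := by
        rintro rfl
        exact hne (by rw [← hs, zero_smul])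
      rcases mem_pointSet.mp hR with rfl | ⟨a, ha, rfl⟩
      · right
        rw [← hs, homEval_smul]
        exact mul_pos ((even_two_mul 3).pow_pos hs0) hgQ
      · left
        rw [Prod.smul_mk, Prod.mk.injEq, smul_eq_mul, mul_one] at hs
        obtain ⟨rfl, rfl⟩ := hs
        refine ⟨hs0, ?_⟩
        rw [smul_smul, inv_mul_cancel₀ hs0, one_smul]
        exact ha)
  set σ := ∑ j, ![f₁, f₂] j ^ 2 with hσ
  have hle : ∀ c, (σ + C c * g).totalDegree ≤ 6 := fun c =>
    (totalDegree_add _ _).trans (max_le (totalDegree_sum_sq_le fun j => (hf j).1)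
      (by rw [C_mul']; exact (totalDegree_smul_le _ _).trans hg.1))
  -- If the degree dropped for both c and c / 2, the degree-6 component of σ would vanish. It is a
  -- sum of squares including that of the leading form of f₁, so this is impossible.
  have hdeg : ∃ c', 0 < c' ∧ c' ≤ c ∧ (σ + C c' * g).totalDegree = 6 := by
    by_contra! hcon
    have hlow : ∀ c', 0 < c' → c' ≤ c → homogeneousComponent 6 (σ + C c' * g) = 0 :=
      fun c' h1 h2 => homogeneousComponent_eq_zero _ _ (lt_of_le_of_ne (hle c') (hcon c' h1 h2))
    have e1 := hlow c hc le_rfl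
    have e2 := hlow (c / 2) (by linarith) (by linarith)
    rw [map_add, C_mul', map_smul] at e1 e2
    have hσ0 : homogeneousComponent 6 σ = 0 := by
      have : (2 : ℝ) • (homogeneousComponent 6 σ + (c / 2) • homogeneousComponent 6 g) -
          (homogeneousComponent 6 σ + c • homogeneousComponent 6 g) =
          homogeneousComponent 6 σ := by module
      rw [← this, e1, e2, smul_zero, sub_zero]
    refine homogeneousComponent_ne_zero H.degree_fst (MvPolynomial.funext fun x => ?_)
    have h6 : homEval (2 * 3) (x, 0) σ = 0 := by rw [homEval_zero, hσ0, map_zero]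
    rw [homEval_sum_sq fun j => (hf j).1,
      Finset.sum_eq_zero_iff_of_nonneg fun _ _ => sq_nonneg _] at h6
    rw [map_zero, ← homEval_zero]
    exact pow_eq_zero_iff two_ne_zero |>.mp (h6 0 (Finset.mem_univ _))
  obtain ⟨c', h1, h2, h3⟩ := hdeg
  refine ⟨_, h3, hpsd c' h1 h2, fun a ha => ?_, not_isSumSq_add hf hg hg' h1.ne'⟩
  change eval a _ = 0
  simp [hσ, (hg.2 a ha).1, H.zeros_fst a ha, H.zeros_snd a ha]

theorem linearIndependent (H : IsCubicPair f₁ f₂ A Q) : LinearIndependent ℝ ![f₁, f₂] := by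
  refine LinearIndependent.pair_iff.mpr fun s t hst => ?_
  rw [← C_mul', ← C_mul'] at hst
  simpa using eq_zero_of_comb_eq_zero H.isRelPrime H.degree_snd (by simp) hst

/-- With an affine ninth point, all nine common zeros are affine: none lies at infinity, and `q` is
the only possible forced zero. -/
theorem applies {q : Fin 2 → ℝ} (H : IsCubicPair f₁ f₂ A (q, 1)) :
    Applies 3 (A : Set (Fin 2 → ℝ)) := by
  refine ⟨?_, fun s f g h => h.exists_isPsd_not_isSumSq⟩
  obtain ⟨g, hg, hg', hgQ⟩ := H.exists_perturbation
  have hforced : ∀ w ∈ forcedZeros 3 (A : Set (Fin 2 → ℝ)), w = q := by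
    rintro w ⟨hw, hwA⟩
    have hne : ((w, 1) : (Fin 2 → ℝ) × ℝ) ≠ 0 := by simp [Prod.ext_iff]
    obtain ⟨R, hR, c, hc⟩ := H.exists_smul_eq hne
      (by rw [homEval_one H.degree_fst.le]; exact hw _ H.fst_mem)
      (by rw [homEval_one H.degree_snd.le]; exact hw _ H.snd_mem)
    have hR2 : R.2 = 1 := by
      rcases mem_pointSet.mp hR with rfl | ⟨a, ha, rfl⟩ <;> rfl
    have hc1 : c = 1 := by simpa [hR2] using congrArg Prod.snd hc
    rw [hc1, one_smul] at hc
    subst hc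
    rcases mem_pointSet.mp hR with h | ⟨a, ha, h⟩
    · exact (Prod.ext_iff.mp h).1
    · obtain rfl : a = w := (Prod.ext_iff.mp h).1
      exact absurd ha hwA
  refine ⟨2, ![f₁, f₂], g, ⟨A.finite_toSet, H.linearIndependent, H.span_eq,
    (Set.finite_singleton q).subset hforced, H.isFull, ?_, hg, hg', fun w hw => ?_⟩⟩
  · rintro v ⟨hv, h⟩
    rw [← homEval_zero, homEval_sum_sq (by
      intro j; fin_cases j; exacts [H.degree_fst.le, H.degree_snd.le]), Fin.sum_univ_two] at h
    simp only [Matrix.cons_val_zero, Matrix.cons_val_one] at h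
    have h1 : homEval 3 (v, 0) f₁ = 0 := by
      nlinarith [sq_nonneg (homEval 3 (v, 0) f₁), sq_nonneg (homEval 3 (v, 0) f₂)]
    have h2 : homEval 3 (v, 0) f₂ = 0 := by
      nlinarith [sq_nonneg (homEval 3 (v, 0) f₁), sq_nonneg (homEval 3 (v, 0) f₂)]
    have hne : ((v, 0) : (Fin 2 → ℝ) × ℝ) ≠ 0 := by simpa [Prod.ext_iff] using hv
    obtain ⟨R, hR, c, hc⟩ := H.exists_smul_eq hne h1 h2
    have hR2 : R.2 = 1 := by
      rcases mem_pointSet.mp hR with rfl | ⟨a, ha, rfl⟩ <;> rfl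
    have hc0 : c = 0 := by simpa [hR2] using congrArg Prod.snd hc
    exact hne (by rw [← hc, hc0, zero_smul])
  · rw [hforced w hw, ← homEval_one hg.1]
    exact hgQ

end IsCubicPair

/-! ### Copacetic sets -/

/-- The eight points of a copacetic set lie on a pencil of relatively prime cubics. -/
theorem IsCopacetic.exists_cubics {A : Finset (Fin 2 → ℝ)}
    (hA : IsCopacetic (A : Set (Fin 2 → ℝ))) :
    ∃ f₁ ∈ vanishingSpace 3 (A : Set (Fin 2 → ℝ)), ∃ f₂ ∈ vanishingSpace 3 (A : Set (Fin 2 → ℝ)),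
      f₁.totalDegree = 3 ∧ f₂.totalDegree = 3 ∧ IsRelPrime f₁ f₂ := by
  classical
  have hcard : A.card = 8 := by simpa using hA.ncard_eq
  have hzeros : ∀ q : MvPolynomial (Fin 2) ℝ,
      ((A : Set (Fin 2 → ℝ)) ∩ zeros q).ncard = (A.filter fun a => eval a q = 0).card := by
    intro q
    rw [← Set.ncard_coe_finset]
    congr 1
    ext a
    simp [zeros]
  have hdeg : ∀ p ∈ vanishingSpace 3 (A : Set (Fin 2 → ℝ)), p ≠ 0 → p.totalDegree = 3 := by
    intro p hp hp0
    by_contra hne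
    have h := hA.quadratic p hp0 (by have := hp.1; omega)
    rw [hzeros, Finset.filter_true_of_mem hp.2] at h
    omega
  let Φ : restrictTotalDegree (Fin 2) ℝ 3 →ₗ[ℝ] (A → ℝ) :=
    (LinearMap.pi fun a : A => (aeval a.1).toLinearMap) ∘ₗ Submodule.subtype _
  -- Cubics have dimension 10, and eight points impose at most 8 conditions.
  have hker : 1 < Module.finrank ℝ (LinearMap.ker Φ) := by
    have h3 := LinearMap.finrank_range_add_finrank_ker Φ
    have h4 := Submodule.finrank_le (LinearMap.range Φ)
    have h5 := finrank_restrictTotalDegree 3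
    rw [Module.finrank_fintype_fun_eq_card, Fintype.card_coe] at h4
    omega
  obtain ⟨⟨⟨f₁, hf₁⟩, hk₁⟩, hne⟩ :=
    (Module.finrank_pos_iff_exists_ne_zero (R := ℝ) (M := LinearMap.ker Φ)).mp (by omega)
  obtain ⟨⟨⟨f₂, hf₂⟩, hk₂⟩, hind⟩ := exists_linearIndependent_pair_of_one_lt_finrank hker hne
  have hmem : ∀ (f : MvPolynomial (Fin 2) ℝ) (hf : f ∈ restrictTotalDegree (Fin 2) ℝ 3),
      (⟨f, hf⟩ : restrictTotalDegree (Fin 2) ℝ 3) ∈ LinearMap.ker Φ →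
      f ∈ vanishingSpace 3 (A : Set (Fin 2 → ℝ)) := fun f hf hk =>
    ⟨(mem_restrictTotalDegree _ _ _).mp hf, fun a ha =>
      congrFun (LinearMap.mem_ker.mp hk) ⟨a, ha⟩⟩
  have hpair : ∀ s t : ℝ, s • f₁ + t • f₂ = 0 → s = 0 ∧ t = 0 := fun s t hst =>
    LinearIndependent.pair_iff.mp hind s t (Subtype.ext (Subtype.ext hst))
  have hf₁0 : f₁ ≠ 0 := by
    rintro rfl
    simpa using (hpair 1 0 (by simp)).1
  have hf₂0 : f₂ ≠ 0 := by
    rintro rfl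
    simpa using (hpair 0 1 (by simp)).2
  have hm₁ := hmem f₁ hf₁ hk₁
  have hm₂ := hmem f₂ hf₂ hk₂
  have hd₁ := hdeg f₁ hm₁ hf₁0
  have hd₂ := hdeg f₂ hm₂ hf₂0
  refine ⟨f₁, hm₁, f₂, hm₂, hd₁, hd₂, ?_⟩
  obtain ⟨q₁, q₂, r, hrel, rfl, rfl⟩ :=
    UniqueFactorizationMonoid.exists_reduced_factors f₁ hf₁0 f₂
  have hr0 : r ≠ 0 := left_ne_zero_of_mul hf₁0
  have hq₁0 : q₁ ≠ 0 := right_ne_zero_of_mul hf₁0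
  have hq₂0 : q₂ ≠ 0 := right_ne_zero_of_mul hf₂0
  rw [totalDegree_mul_of_isDomain hr0 hq₁0] at hd₁
  rw [totalDegree_mul_of_isDomain hr0 hq₂0] at hd₂
  -- Points of `A` off the common factor r are common zeros of the coprime cofactors, so Bezout's
  -- inequality bounds their number.
  have hbez : (A.filter fun a => eval a r ≠ 0).card ≤ q₁.totalDegree * q₂.totalDegree := by
    rw [← Finset.card_image_of_injective (A.filter fun a => eval a r ≠ 0)
      (f := fun a => (a, (1 : ℝ))) fun a b h => (Prod.ext_iff.mp h).1]
    refine (isPointSet_image _).card_le hrel hq₂0 rfl rfl ?_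
    simp only [Finset.forall_mem_image, Finset.mem_filter]
    intro a ⟨ha, har⟩
    rw [homEval_one le_rfl, homEval_one le_rfl]
    have e1 := hm₁.2 a ha
    have e2 := hm₂.2 a ha
    rw [map_mul] at e1 e2
    exact ⟨(mul_eq_zero.mp e1).resolve_left har, (mul_eq_zero.mp e2).resolve_left har⟩
  have hsum := Finset.card_filter_add_card_filter_not (s := A) fun a => eval a r = 0
  have hline := hA.line r hr0
  have hquad := hA.quadratic r hr0
  rw [hzeros] at hline hquad
  obtain ⟨k, hk⟩ : ∃ k, r.totalDegree = k := ⟨_, rfl⟩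
  have hk3 : k ≤ 3 := by omega
  rw [hk] at hline hquad hd₁ hd₂
  have h1 : q₁.totalDegree = 3 - k := by omega
  have h2 : q₂.totalDegree = 3 - k := by omega
  rw [h1, h2] at hbez
  -- A linear r accounts for at most 3 + 4 points and a quadratic r for at most 6 + 1, both fewer
  -- than 8. A cubic r would make f₁ and f₂ proportional.
  interval_cases k
  · rw [totalDegree_eq_zero_iff_eq_C] at hk
    have hu : IsUnit r := by
      rw [hk]
      refine (isUnit_iff_ne_zero.mpr fun h => hr0 ?_).map C
      rw [hk, h, map_zero]
    exact (isRelPrime_mul_unit_left hu).mpr hrel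
  · have := hline le_rfl
    simp only [ne_eq] at hbez
    omega
  · have := hquad le_rfl
    simp only [ne_eq] at hbez
    omega
  · exfalso
    rw [Nat.sub_self, totalDegree_eq_zero_iff_eq_C] at h1 h2
    have h := hpair (coeff 0 q₂) (-coeff 0 q₁) (by
      rw [← C_mul', ← C_mul', map_neg]
      linear_combination (r * C (coeff 0 q₂)) * h1 - (r * C (coeff 0 q₁)) * h2)
    rw [h.1, map_zero] at h2
    exact hq₂0 h2

theorem IsCopacetic.hasPsdNotSosSextic {A : Set (Fin 2 → ℝ)} (hA : IsCopacetic A) :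
    HasPsdNotSosSextic A := by
  have hfin : A.Finite := Set.finite_of_ncard_ne_zero (by rw [hA.ncard_eq]; norm_num)
  lift A to Finset (Fin 2 → ℝ) using hfin
  obtain ⟨f₁, hm₁, f₂, hm₂, hd₁, hd₂, hrel⟩ := hA.exists_cubics
  have hcard : A.card = 8 := by simpa using hA.ncard_eq
  rcases hA.ninth with ⟨q, hq, hqA⟩ | ⟨v, hv⟩
  · refine IsCubicPair.hasPsdNotSosSextic (f₁ := f₁) (f₂ := f₂) (Q := (q, 1))
      ⟨hrel, hd₁, hd₂, hcard, by simp [Prod.ext_iff], ?_, hm₁.2, hm₂.2, ?_, ?_⟩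
    · intro a ha c hc
      obtain ⟨h1, rfl⟩ := Prod.mk.inj hc
      rw [one_smul] at h1
      exact hqA (h1 ▸ ha)
    · rw [homEval_one hd₁.le]; exact hq _ hm₁
    · rw [homEval_one hd₂.le]; exact hq _ hm₂
  · refine IsCubicPair.hasPsdNotSosSextic (f₁ := f₁) (f₂ := f₂) (Q := (v, 0))
      ⟨hrel, hd₁, hd₂, hcard, by simpa [Prod.ext_iff] using (hv _ hm₁).1, ?_, hm₁.2, hm₂.2,
        ?_, ?_⟩
    · intro a ha c hc
      obtain ⟨h1, rfl⟩ := Prod.mk.inj hc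
      rw [zero_smul] at h1
      exact (hv _ hm₁).1 h1.symm
    · rw [homEval_zero]; exact (hv _ hm₁).2
    · rw [homEval_zero]; exact (hv _ hm₂).2

theorem exists_isCubicPair {f₁ f₂ : MvPolynomial (Fin 2) ℝ} (hd₁ : f₁.totalDegree = 3)
    (hd₂ : f₂.totalDegree = 3) (hrel : IsRelPrime f₁ f₂)
    (hz : (zeros f₁ ∩ zeros f₂).ncard = 9) {A : Finset (Fin 2 → ℝ)}
    (hA : (A : Set (Fin 2 → ℝ)) ⊆ zeros f₁ ∩ zeros f₂) (hcard : A.card = 8) :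
    ∃ q, IsCubicPair f₁ f₂ A (q, 1) := by
  obtain ⟨q, hq, hqA⟩ : ∃ q ∈ zeros f₁ ∩ zeros f₂, q ∉ (A : Set (Fin 2 → ℝ)) := by
    refine Set.exists_mem_notMem_of_ncard_lt_ncard ?_
    rw [hz, Set.ncard_coe_finset, hcard]
    norm_num
  refine ⟨q, hrel, hd₁, hd₂, hcard, by simp [Prod.ext_iff], ?_, fun a ha => (hA ha).1,
    fun a ha => (hA ha).2, ?_, ?_⟩
  · intro a ha c hc
    obtain ⟨h1, rfl⟩ := Prod.mk.inj hc
    rw [one_smul] at h1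
    exact hqA (h1 ▸ ha)
  · rw [homEval_one hd₁.le]; exact hq.1
  · rw [homEval_one hd₂.le]; exact hq.2

end HilbertMethod

theorem theorem4p1 :
    (∀ f₁ f₂ : MvPolynomial (Fin 2) ℝ,
      f₁.totalDegree = 3 → f₂.totalDegree = 3 → IsRelPrime f₁ f₂ →
      (HilbertMethod.zeros f₁ ∩ HilbertMethod.zeros f₂).ncard = 9 →
      ∀ A : Set (Fin 2 → ℝ), A ⊆ HilbertMethod.zeros f₁ ∩ HilbertMethod.zeros f₂ →
        A.ncard = 8 →
        HilbertMethod.Applies 3 A ∧ HilbertMethod.HasPsdNotSosSextic A) ∧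
    (∀ A : Set (Fin 2 → ℝ), HilbertMethod.IsCopacetic A →
      HilbertMethod.HasPsdNotSosSextic A) := by
  refine ⟨fun f₁ f₂ hd₁ hd₂ hrel hz A hA hcard => ?_, fun A hA => hA.hasPsdNotSosSextic⟩
  have hfin : A.Finite := Set.finite_of_ncard_ne_zero (by rw [hcard]; norm_num)
  lift A to Finset (Fin 2 → ℝ) using hfin
  obtain ⟨q, H⟩ := HilbertMethod.exists_isCubicPair hd₁ hd₂ hrel hz hA (by simpa using hcard)
  exact ⟨H.applies, H.hasPsdNotSosSextic⟩
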